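/- **Theorem 4.1.** Let $L^1(\mathbb R^2)$ be the space of (real- or complex-valued) integrable functions on $\mathbb R^2$. An *atom* is a function $a$ for which there is a square $Q=[c_1,c_1+s]\times[c_2,c_2+s]$, $s>0$, such that $a$ vanishes outside $Q$, $|a|\le 1/|Q|$ almost everywhere, and $\int_Q a=0$. Let $H^1(\mathbb R^2)$ be the space of all $f\in L^1(\mathbb R^2)$ that can be written as $f=\sum_{j\ge1}\lambda_j a_j$, with convergence in $L^1$, where the $a_j$ are atoms and $\lambda_j$ are scalars with $\sum_j|\lambda_j|<\infty$, normed by $$\|f\|_{H^1}=\inf\Big\{\sum_j|\lambda_j| : f=\sum_j\lambda_ja_j\Big\},$$ the infimum being taken over all such decompositions. Let $H=\chi_{[0,1/2)}-\chi_{[1/2,1)}$, $$\Psi_1(x,y)=H(x)\,\chi_{[0,1]}(y),\quad \Psi_2(x,y)=\chi_{[0,1]}(x)\,H(y),\quad \Psi_3(x,y)=H(x)\,H(y),$$ and let the two-dimensional Haar system consist of the functions $$\Psi_{j,n,k,l}(x,y)=2^n\,\Psi_j(2^nx-k,\,2^ny-l),\qquad j\in\{1,2,3\},\ n,k,l\in\mathbb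 Z,$$ all of which belong to $H^1(\mathbb R^2)$. Then the closure, in the norm of $H^1(\mathbb R^2)$, of the linear span of the two-dimensional Haar system is $$H^A(\mathbb R^2)=\Big\{f\in H^1(\mathbb R^2) : \iint_{Q_i} f\,dx\,dy=0,\ i=1,2,3,4\Big\},$$ where $Q_1,Q_2,Q_3,Q_4$ are the four quadrants of $\mathbb R^2$. -/

import Mathlib

open MeasureTheory Set

noncomputable section

namespace HardyHaar

/-- The closed axis-parallel square with lower left corner `c` and side length `s`. -/
def square (c : ℝ × ℝ) (s : ℝ) : Set (ℝ × ℝ) :=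
  Icc c.1 (c.1 + s) ×ˢ Icc c.2 (c.2 + s)

/-- `a ∈ L¹(ℝ²)` is an `L^∞` atom: for some square `Q` of side length `s > 0`, `a` vanishes
outside `Q`, `|a| ≤ 1 / |Q| = 1 / s²`, and `a` has integral zero over `Q`
(all up to null sets, as `a` is a class of functions). -/
def IsAtom {𝕜 : Type*} [RCLike 𝕜] (a : Lp 𝕜 1 (volume : Measure (ℝ × ℝ))) : Prop :=
  ∃ (c : ℝ × ℝ) (s : ℝ), 0 < s ∧
    (∀ᵐ x ∂(volume : Measure (ℝ × ℝ)), x ∉ square c s → a x = 0) ∧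
    (∀ᵐ x ∂(volume : Measure (ℝ × ℝ)), ‖a x‖ ≤ 1 / s ^ 2) ∧
    ∫ x in square c s, a x = 0

/-- `f = ∑ⱼ λⱼ aⱼ` in `L¹(ℝ²)`, with atoms `aⱼ` and `∑ⱼ |λⱼ| < ∞`. -/
def IsAtomicDecomposition {𝕜 : Type*} [RCLike 𝕜] (coeff : ℕ → 𝕜)
    (a : ℕ → Lp 𝕜 1 (volume : Measure (ℝ × ℝ)))
    (f : Lp 𝕜 1 (volume : Measure (ℝ × ℝ))) : Prop :=
  (∀ j, IsAtom (a j)) ∧ Summable (fun j => ‖coeff j‖) ∧ HasSum (fun j => coeff j • a j) f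

/-- The numbers `∑ⱼ |λⱼ|` taken over all atomic decompositions of `f`. -/
def atomicSums {𝕜 : Type*} [RCLike 𝕜] (f : Lp 𝕜 1 (volume : Measure (ℝ × ℝ))) : Set ℝ :=
  {r | ∃ (coeff : ℕ → 𝕜) (a : ℕ → Lp 𝕜 1 (volume : Measure (ℝ × ℝ))),
    IsAtomicDecomposition coeff a f ∧ r = ∑' j, ‖coeff j‖}

section helpers

variable {𝕜 : Type*} [RCLike 𝕜]

lemma isAtom_zero : IsAtom (0 : Lp 𝕜 1 (volume : Measure (ℝ × ℝ))) := by
  have h := Lp.coeFn_zero 𝕜 1 (volume : Measure (ℝ × ℝ))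
  refine ⟨0, 1, one_pos, ?_, ?_, ?_⟩
  · filter_upwards [h] with x hx _ using by simp [hx]
  · filter_upwards [h] with x hx
    rw [hx]; simp
  · rw [integral_congr_ae (ae_restrict_of_ae h)]; simp

lemma volume_square (c : ℝ × ℝ) {s : ℝ} (hs : 0 < s) :
    volume (square c s) = ENNReal.ofReal (s ^ 2) := by
  rw [square, Measure.volume_eq_prod, Measure.prod_prod, Real.volume_Icc, Real.volume_Icc,
    ← ENNReal.ofReal_mul (by linarith)]
  congr 1; ring

lemma measurableSet_square (c : ℝ × ℝ) (s : ℝ) : MeasurableSet (square c s) :=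
  measurableSet_Icc.prod measurableSet_Icc

lemma IsAtom.norm_le_one {a : Lp 𝕜 1 (volume : Measure (ℝ × ℝ))} (ha : IsAtom a) :
    ‖a‖ ≤ 1 := by
  obtain ⟨c, s, hs, h0, hb, -⟩ := ha
  have hv := volume_square c hs
  have hfin : volume (square c s) < ⊤ := by rw [hv]; exact ENNReal.ofReal_lt_top
  rw [L1.norm_eq_integral_norm, ← setIntegral_eq_integral_of_ae_compl_eq_zero
    (s := square c s) (by filter_upwards [h0] with x hx hxs using by simp [hx hxs])]
  have := norm_setIntegral_le_of_norm_le_const_ae (μ := volume) (f := fun x => ‖a x‖)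
    (C := 1 / s ^ 2) hfin (ae_restrict_of_ae (by filter_upwards [hb] with x hx using by simpa using hx))
  refine (le_abs_self _).trans (this.trans ?_)
  rw [measureReal_def, hv, ENNReal.toReal_ofReal (by positivity)]
  field_simp; exact le_rfl

lemma atomicSums_nonneg {f : Lp 𝕜 1 (volume : Measure (ℝ × ℝ))} {r : ℝ}
    (hr : r ∈ atomicSums f) : 0 ≤ r := by
  obtain ⟨l, a, -, rfl⟩ := hr
  exact tsum_nonneg fun _ => norm_nonneg _

lemma norm_le_of_mem_atomicSums {f : Lp 𝕜 1 (volume : Measure (ℝ × ℝ))} {r : ℝ}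
    (hr : r ∈ atomicSums f) : ‖f‖ ≤ r := by
  obtain ⟨l, a, ⟨ha, hl, hf⟩, rfl⟩ := hr
  rw [← hf.tsum_eq]
  refine tsum_of_norm_bounded hl.hasSum fun j => ?_
  rw [norm_smul]
  exact mul_le_of_le_one_right (norm_nonneg _) (ha j).norm_le_one

lemma zero_mem_atomicSums : (0 : ℝ) ∈ atomicSums (0 : Lp 𝕜 1 (volume : Measure (ℝ × ℝ))) :=
  ⟨fun _ => 0, fun _ => 0, ⟨fun _ => isAtom_zero, by simp,
    by simp [hasSum_zero]⟩, by simp⟩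

lemma smul_mem_atomicSums {f : Lp 𝕜 1 (volume : Measure (ℝ × ℝ))} {r : ℝ} (c : 𝕜)
    (hr : r ∈ atomicSums f) : ‖c‖ * r ∈ atomicSums (c • f) := by
  obtain ⟨l, a, ⟨ha, hl, hf⟩, rfl⟩ := hr
  refine ⟨fun j => c * l j, a, ⟨ha, ?_, ?_⟩, ?_⟩
  · simpa [norm_mul] using hl.mul_left ‖c‖
  · simpa [mul_smul] using hf.const_smul c
  · simp [norm_mul, tsum_mul_left]

lemma add_mem_atomicSums {f g : Lp 𝕜 1 (volume : Measure (ℝ × ℝ))} {r t : ℝ}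
    (hr : r ∈ atomicSums f) (ht : t ∈ atomicSums g) : r + t ∈ atomicSums (f + g) := by
  obtain ⟨l, a, ⟨ha, hl, hf⟩, rfl⟩ := hr
  obtain ⟨m, b, ⟨hb, hm, hg⟩, rfl⟩ := ht
  let e : ℕ ≃ ℕ ⊕ ℕ := Equiv.natSumNatEquivNat.symm
  have hs : HasSum (fun i => ‖Sum.elim l m i‖) ((∑' j, ‖l j‖) + ∑' j, ‖m j‖) :=
    HasSum.sum (f := fun i => ‖Sum.elim l m i‖) hl.hasSum hm.hasSum
  have hv : HasSum (fun i => Sum.elim l m i • Sum.elim a b i) (f + g) :=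
    HasSum.sum (f := fun i => Sum.elim l m i • Sum.elim a b i) hf hg
  refine ⟨Sum.elim l m ∘ e, Sum.elim a b ∘ e, ⟨fun j => ?_, ?_, ?_⟩, ?_⟩
  · rcases h : e j with i | i
    · simpa [h] using ha i
    · simpa [h] using hb i
  · exact (e.summable_iff (f := fun i => ‖Sum.elim l m i‖)).2 hs.summable
  · exact (e.hasSum_iff (f := fun i => Sum.elim l m i • Sum.elim a b i)).2 hv
  · exact ((e.hasSum_iff (f := fun i => ‖Sum.elim l m i‖)).2 hs).tsum_eq.symm

end helpers

/-- The integrable functions on `ℝ²` which admit an atomic decomposition. -/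
def hardySubmodule (𝕜 : Type*) [RCLike 𝕜] :
    Submodule 𝕜 (Lp 𝕜 1 (volume : Measure (ℝ × ℝ))) where
  carrier := {f | (atomicSums f).Nonempty}
  zero_mem' := ⟨0, zero_mem_atomicSums⟩
  add_mem' := fun ⟨_, hr⟩ ⟨_, ht⟩ => ⟨_, add_mem_atomicSums hr ht⟩
  smul_mem' := fun c _ ⟨_, hr⟩ => ⟨_, smul_mem_atomicSums c hr⟩

/-- The Hardy space `H¹(ℝ²)`. It is a type of its own, so that it carries the atomic norm
(below) and not the norm of `L¹(ℝ²)`. -/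
def H1 (𝕜 : Type*) [RCLike 𝕜] : Type _ := hardySubmodule 𝕜

namespace H1

variable {𝕜 : Type*} [RCLike 𝕜]

instance : AddCommGroup (H1 𝕜) := inferInstanceAs (AddCommGroup (hardySubmodule 𝕜))

instance : Module 𝕜 (H1 𝕜) := inferInstanceAs (Module 𝕜 (hardySubmodule 𝕜))

/-- The inclusion of `H¹(ℝ²)` into `L¹(ℝ²)`. -/
def toL1 : H1 𝕜 →ₗ[𝕜] Lp 𝕜 1 (volume : Measure (ℝ × ℝ)) := (hardySubmodule 𝕜).subtype

lemma toL1_injective : Function.Injective (toL1 : H1 𝕜 → Lp 𝕜 1 (volume : Measure (ℝ × ℝ))) :=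
  Subtype.val_injective

lemma nonempty_atomicSums (f : H1 𝕜) : (atomicSums (toL1 f)).Nonempty := f.2

lemma bddBelow_atomicSums (f : H1 𝕜) : BddBelow (atomicSums (toL1 f)) :=
  ⟨0, fun _ hr => atomicSums_nonneg hr⟩

/-- The atomic norm: the infimum of `∑ⱼ |λⱼ|` over all atomic decompositions. -/
instance : Norm (H1 𝕜) := ⟨fun f => sInf (atomicSums (toL1 f))⟩

lemma norm_def (f : H1 𝕜) : ‖f‖ = sInf (atomicSums (toL1 f)) := rfl

lemma norm_le_of_mem {f : H1 𝕜} {r : ℝ} (hr : r ∈ atomicSums (toL1 f)) : ‖f‖ ≤ r :=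
  csInf_le (bddBelow_atomicSums f) hr

lemma norm_toL1_le (f : H1 𝕜) : ‖toL1 f‖ ≤ ‖f‖ :=
  le_csInf (nonempty_atomicSums f) fun _ hr => norm_le_of_mem_atomicSums hr

lemma h1_norm_nonneg (f : H1 𝕜) : 0 ≤ ‖f‖ := (norm_nonneg _).trans (norm_toL1_le f)

lemma h1_norm_add_le (f g : H1 𝕜) : ‖f + g‖ ≤ ‖f‖ + ‖g‖ := by
  refine le_of_forall_pos_le_add fun ε hε => ?_
  obtain ⟨r, hr, hr'⟩ := exists_lt_of_csInf_lt (nonempty_atomicSums f)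
    (show sInf (atomicSums (toL1 f)) < ‖f‖ + ε / 2 by rw [← norm_def]; linarith)
  obtain ⟨t, ht, ht'⟩ := exists_lt_of_csInf_lt (nonempty_atomicSums g)
    (show sInf (atomicSums (toL1 g)) < ‖g‖ + ε / 2 by rw [← norm_def]; linarith)
  have h : r + t ∈ atomicSums (toL1 (f + g)) := by
    rw [map_add]; exact add_mem_atomicSums hr ht
  linarith [norm_le_of_mem h]

lemma h1_norm_smul_le (c : 𝕜) (f : H1 𝕜) : ‖c • f‖ ≤ ‖c‖ * ‖f‖ := by
  refine le_of_forall_pos_le_add fun ε hε => ?_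
  have hc : 0 ≤ ‖c‖ := norm_nonneg c
  obtain ⟨r, hr, hr'⟩ := exists_lt_of_csInf_lt (nonempty_atomicSums f)
    (show sInf (atomicSums (toL1 f)) < ‖f‖ + ε / (‖c‖ + 1) by
      rw [← norm_def]; linarith [show 0 < ε / (‖c‖ + 1) by positivity])
  have h : ‖c‖ * r ∈ atomicSums (toL1 (c • f)) := by
    rw [map_smul]; exact smul_mem_atomicSums c hr
  have h1 : ‖c‖ * r ≤ ‖c‖ * (‖f‖ + ε / (‖c‖ + 1)) := mul_le_mul_of_nonneg_left hr'.le hc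
  have h2 : ‖c‖ * (ε / (‖c‖ + 1)) ≤ ε := by
    rw [mul_div_assoc', div_le_iff₀ (by positivity)]; nlinarith
  linarith [norm_le_of_mem h]

lemma h1_norm_zero : ‖(0 : H1 𝕜)‖ = 0 :=
  le_antisymm (norm_le_of_mem (by rw [map_zero]; exact zero_mem_atomicSums)) (h1_norm_nonneg 0)

lemma normedSpaceCore : NormedSpace.Core 𝕜 (H1 𝕜) where
  norm_nonneg := h1_norm_nonneg
  norm_triangle := h1_norm_add_le
  norm_eq_zero_iff f := by
    refine ⟨fun h => toL1_injective ?_, fun h => by rw [h, h1_norm_zero]⟩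
    rw [map_zero]
    exact norm_le_zero_iff.1 (h ▸ norm_toL1_le f)
  norm_smul c f := by
    refine le_antisymm (h1_norm_smul_le c f) ?_
    rcases eq_or_ne c 0 with rfl | hc
    · simpa using h1_norm_nonneg _
    · have h := h1_norm_smul_le c⁻¹ (c • f)
      rw [inv_smul_smul₀ hc, norm_inv] at h
      have hc' : 0 < ‖c‖ := norm_pos_iff.2 hc
      calc ‖c‖ * ‖f‖ ≤ ‖c‖ * (‖c‖⁻¹ * ‖c • f‖) := mul_le_mul_of_nonneg_left h hc'.le
        _ = ‖c • f‖ := by rw [← mul_assoc, mul_inv_cancel₀ hc'.ne', one_mul]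

instance : NormedAddCommGroup (H1 𝕜) := NormedAddCommGroup.ofCore (normedSpaceCore (𝕜 := 𝕜))

instance : NormedSpace 𝕜 (H1 𝕜) := NormedSpace.ofCore (normedSpaceCore (𝕜 := 𝕜))

end H1

/-- The Haar function `H` of the unit interval. -/
def haarH (x : ℝ) : ℝ :=
  (Ico (0 : ℝ) (1 / 2)).indicator 1 x - (Ico (1 / 2 : ℝ) 1).indicator 1 x

/-- The indicator function of `[0, 1]`. -/
def chi (x : ℝ) : ℝ := (Icc (0 : ℝ) 1).indicator 1 x

/-- The three basic functions `Ψ₁`, `Ψ₂`, `Ψ₃`. -/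
def Psi : Fin 3 → ℝ → ℝ → ℝ :=
  ![fun x y => haarH x * chi y, fun x y => chi x * haarH y, fun x y => haarH x * haarH y]

/-- `Ψ_{j,n,k,l}(x, y) = 2ⁿ Ψ_j(2ⁿ x - k, 2ⁿ y - l)`. -/
def haarFun (j : Fin 3) (n k l : ℤ) (p : ℝ × ℝ) : ℝ :=
  (2 : ℝ) ^ n * Psi j ((2 : ℝ) ^ n * p.1 - k) ((2 : ℝ) ^ n * p.2 - l)

section helpers

lemma measurable_haarH : Measurable haarH :=
  (measurable_one.indicator measurableSet_Ico).sub (measurable_one.indicator measurableSet_Ico)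

lemma measurable_chi : Measurable chi := measurable_one.indicator measurableSet_Icc

lemma abs_haarH_le (x : ℝ) : |haarH x| ≤ 1 := by
  unfold haarH indicator
  split_ifs with h1 h2 <;> simp_all

lemma abs_chi_le (x : ℝ) : |chi x| ≤ 1 := by
  unfold chi indicator
  split_ifs <;> simp

lemma haarH_eq_zero {x : ℝ} (hx : x ∉ Icc (0 : ℝ) 1) : haarH x = 0 := by
  have h1 : x ∉ Ico (0 : ℝ) (1 / 2) := fun h => hx ⟨h.1, by linarith [h.2]⟩
  have h2 : x ∉ Ico (1 / 2 : ℝ) 1 := fun h => hx ⟨by linarith [h.1], h.2.le⟩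
  simp only [haarH, indicator_of_notMem h1, indicator_of_notMem h2, sub_zero]

lemma chi_eq_zero {x : ℝ} (hx : x ∉ Icc (0 : ℝ) 1) : chi x = 0 := indicator_of_notMem hx _

lemma integral_haarH : ∫ x, haarH x = 0 := by
  unfold haarH
  rw [integral_sub]
  · rw [integral_indicator_one measurableSet_Ico, integral_indicator_one measurableSet_Ico]
    simp only [measureReal_def, Real.volume_Ico]
    norm_num
  · exact (integrable_indicator_iff measurableSet_Ico).2 (integrableOn_const (by simp))
  · exact (integrable_indicator_iff measurableSet_Ico).2 (integrableOn_const (by simp))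

lemma integral_haarH_comp (n k : ℤ) : ∫ x, haarH ((2 : ℝ) ^ n * x - k) = 0 := by
  rw [Measure.integral_comp_mul_left (fun x => haarH (x - k)) ((2 : ℝ) ^ n),
    integral_sub_right_eq_self haarH (k : ℝ), integral_haarH, smul_zero]

lemma measurable_haarFun (j : Fin 3) (n k l : ℤ) : Measurable (haarFun j n k l) := by
  have := measurable_haarH
  have := measurable_chi
  unfold haarFun Psi
  fin_cases j <;> simp <;> fun_prop

lemma abs_haarFun_le (j : Fin 3) (n k l : ℤ) (p : ℝ × ℝ) : |haarFun j n k l p| ≤ (2 : ℝ) ^ n := by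
  have h : ∀ x y, |Psi j x y| ≤ 1 := fun x y => by
    fin_cases j <;> simp only [Psi, Fin.mk_zero, Fin.mk_one, Fin.reduceFinMk, Matrix.cons_val, Matrix.cons_val_zero,
      Matrix.cons_val_one, abs_mul] <;>
    first
      | exact mul_le_one₀ (abs_haarH_le _) (abs_nonneg _) (abs_chi_le _)
      | exact mul_le_one₀ (abs_chi_le _) (abs_nonneg _) (abs_haarH_le _)
      | exact mul_le_one₀ (abs_haarH_le _) (abs_nonneg _) (abs_haarH_le _)
  rw [haarFun, abs_mul, abs_of_pos (by positivity : (0 : ℝ) < 2 ^ n)]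
  exact mul_le_of_le_one_right (by positivity) (h _ _)

lemma haarFun_eq_zero (j : Fin 3) (n k l : ℤ) {p : ℝ × ℝ}
    (hp : p ∉ square (k * (2 : ℝ) ^ (-n), l * (2 : ℝ) ^ (-n)) ((2 : ℝ) ^ (-n))) :
    haarFun j n k l p = 0 := by
  have key : ∀ (x : ℝ) (m : ℤ), (2 : ℝ) ^ n * x - m ∈ Icc (0 : ℝ) 1 →
      x ∈ Icc (m * (2 : ℝ) ^ (-n)) (m * (2 : ℝ) ^ (-n) + (2 : ℝ) ^ (-n)) := by
    intro x m h
    have h2 : (0 : ℝ) < 2 ^ n := by positivity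
    rw [zpow_neg]
    constructor
    · rw [← div_eq_mul_inv, div_le_iff₀ h2]; linarith [h.1]
    · rw [← add_one_mul, ← div_eq_mul_inv, le_div_iff₀ h2]; linarith [h.2]
  have hor : (2 : ℝ) ^ n * p.1 - k ∉ Icc (0 : ℝ) 1 ∨ (2 : ℝ) ^ n * p.2 - l ∉ Icc (0 : ℝ) 1 := by
    by_contra! h
    exact hp ⟨key _ _ h.1, key _ _ h.2⟩
  rcases hor with h | h <;> fin_cases j <;>
    simp [haarFun, Psi, haarH_eq_zero h, chi_eq_zero h]

lemma integral_haarFun (j : Fin 3) (n k l : ℤ) : ∫ p, haarFun j n k l p = 0 := by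
  unfold haarFun
  rw [integral_const_mul, Measure.volume_eq_prod]
  fin_cases j
  · exact mul_eq_zero_of_right _ ((integral_prod_mul (fun x => haarH ((2 : ℝ) ^ n * x - k))
      (fun y => chi ((2 : ℝ) ^ n * y - l))).trans (by rw [integral_haarH_comp, zero_mul]))
  · exact mul_eq_zero_of_right _ ((integral_prod_mul (fun x => chi ((2 : ℝ) ^ n * x - k))
      (fun y => haarH ((2 : ℝ) ^ n * y - l))).trans (by rw [integral_haarH_comp, mul_zero]))
  · exact mul_eq_zero_of_right _ ((integral_prod_mul (fun x => haarH ((2 : ℝ) ^ n * x - k))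
      (fun y => haarH ((2 : ℝ) ^ n * y - l))).trans (by rw [integral_haarH_comp, zero_mul]))

lemma memLp_haarFun (𝕜 : Type*) [RCLike 𝕜] (j : Fin 3) (n k l : ℤ) :
    MemLp (fun p => (haarFun j n k l p : 𝕜)) 1 (volume : Measure (ℝ × ℝ)) := by
  set Q := square (k * (2 : ℝ) ^ (-n), l * (2 : ℝ) ^ (-n)) ((2 : ℝ) ^ (-n)) with hQ
  have hQm : MeasurableSet Q := measurableSet_square _ _
  have hfin : volume Q < ⊤ := by
    rw [hQ, volume_square _ (by positivity)]; exact ENNReal.ofReal_lt_top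
  rw [memLp_one_iff_integrable]
  have hon : IntegrableOn (haarFun j n k l) Q :=
    Measure.integrableOn_of_bounded (M := (2 : ℝ) ^ n) hfin.ne
      (measurable_haarFun j n k l).aestronglyMeasurable
      (Filter.Eventually.of_forall fun p => by simpa using abs_haarFun_le j n k l p)
  exact ((integrableOn_iff_integrable_of_support_subset (fun p hp => by
    by_contra h
    exact hp (haarFun_eq_zero j n k l h))).1 hon).ofReal

/-- Each Haar function, as an element of `L¹(ℝ²)`, is in `H¹(ℝ²)`, being a multiple of an atom. -/
lemma haar_mem (𝕜 : Type*) [RCLike 𝕜] (j : Fin 3) (n k l : ℤ) :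
    (memLp_haarFun 𝕜 j n k l).toLp ∈ hardySubmodule 𝕜 := by
  set F := (memLp_haarFun 𝕜 j n k l).toLp with hF
  have h2 : (0 : ℝ) < 2 ^ n := by positivity
  have h2' : ((2 : ℝ) ^ n : ℝ) ≠ 0 := h2.ne'
  have hFe : ∀ᵐ p, F p = (haarFun j n k l p : 𝕜) := (memLp_haarFun 𝕜 j n k l).coeFn_toLp
  have hae := Lp.coeFn_smul (((2 : ℝ) ^ n : ℝ) : 𝕜) F
  have hatom : IsAtom ((((2 : ℝ) ^ n : ℝ) : 𝕜) • F) := by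
    refine ⟨(k * (2 : ℝ) ^ (-n), l * (2 : ℝ) ^ (-n)), (2 : ℝ) ^ (-n), by positivity, ?_, ?_, ?_⟩
    · filter_upwards [hFe, hae] with p h1 h3 hp
      rw [h3, Pi.smul_apply, h1, haarFun_eq_zero j n k l hp]; simp
    · filter_upwards [hFe, hae] with p h1 h3
      rw [h3, Pi.smul_apply, h1, norm_smul, RCLike.norm_ofReal, RCLike.norm_ofReal, abs_of_pos h2]
      have := abs_haarFun_le j n k l p
      calc (2 : ℝ) ^ n * |haarFun j n k l p| ≤ 2 ^ n * 2 ^ n := by gcongr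
        _ = 1 / ((2 : ℝ) ^ (-n)) ^ 2 := by rw [zpow_neg]; field_simp
    · rw [setIntegral_eq_integral_of_ae_compl_eq_zero]
      · rw [integral_congr_ae hae]
        simp only [Pi.smul_apply, integral_smul]
        rw [integral_congr_ae hFe, integral_ofReal, integral_haarFun]; simp
      · filter_upwards [hFe, hae] with p h1 h3 hp
        rw [h3, Pi.smul_apply, h1, haarFun_eq_zero j n k l hp]; simp
  have hA : (((2 : ℝ) ^ n : ℝ) : 𝕜) • F ∈ hardySubmodule 𝕜 := by
    refine ⟨1, fun i => if i = 0 then 1 else 0, fun _ => (((2 : ℝ) ^ n : ℝ) : 𝕜) • F,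
      ⟨fun _ => hatom, ?_, ?_⟩, ?_⟩
    · exact summable_of_ne_finset_zero (s := {0}) fun i hi => by simp_all
    · simpa using hasSum_single (f := fun i : ℕ =>
        (if i = 0 then (1 : 𝕜) else 0) • (((2 : ℝ) ^ n : ℝ) : 𝕜) • F) 0
        (fun i hi => by simp [hi])
    · rw [tsum_eq_single 0 (fun i hi => by simp [hi])]; simp
  have hne : (((2 : ℝ) ^ n : ℝ) : 𝕜) ≠ 0 := by exact_mod_cast h2'
  have h := (hardySubmodule 𝕜).smul_mem ((((2 : ℝ) ^ n : ℝ) : 𝕜)⁻¹) hA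
  rwa [inv_smul_smul₀ hne] at h

end helpers

/-- The Haar function `Ψ_{j,n,k,l}` as an element of `H¹(ℝ²)`. -/
def haar (𝕜 : Type*) [RCLike 𝕜] (j : Fin 3) (n k l : ℤ) : H1 𝕜 :=
  ⟨(memLp_haarFun 𝕜 j n k l).toLp, haar_mem 𝕜 j n k l⟩

/-- The two-dimensional Haar system in `H¹(ℝ²)`. -/
def haarSystem (𝕜 : Type*) [RCLike 𝕜] : Set (H1 𝕜) :=
  {f | ∃ (j : Fin 3) (n k l : ℤ), f = haar 𝕜 j n k l}

/-- The four (open) quadrants of the plane. -/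
def quadrant : Fin 4 → Set (ℝ × ℝ) :=
  ![Ioi 0 ×ˢ Ioi 0, Iio 0 ×ˢ Ioi 0, Iio 0 ×ˢ Iio 0, Ioi 0 ×ˢ Iio 0]

/-- `H^A(ℝ²)`: the functions in `H¹(ℝ²)` with integral zero over each quadrant. -/
def HA (𝕜 : Type*) [RCLike 𝕜] : Submodule 𝕜 (H1 𝕜) where
  carrier := {f | ∀ i, ∫ p in quadrant i, H1.toL1 f p = 0}
  zero_mem' i := by
    rw [map_zero, integral_congr_ae (ae_restrict_of_ae (Lp.coeFn_zero 𝕜 1 volume))]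
    simp
  add_mem' {f g} hf hg i := by
    rw [map_add, integral_congr_ae (ae_restrict_of_ae (Lp.coeFn_add _ _))]
    simp only [Pi.add_apply]
    rw [integral_add (L1.integrable_coeFn _).integrableOn (L1.integrable_coeFn _).integrableOn,
      hf i, hg i, add_zero]
  smul_mem' c f hf i := by
    rw [map_smul, integral_congr_ae (ae_restrict_of_ae (Lp.coeFn_smul _ _))]
    simp only [Pi.smul_apply]
    rw [integral_smul, hf i, smul_zero]

end HardyHaar

end

noncomputable section

namespace HardyHaar

open Filter Topology

/-! One inclusion is soft. The supporting square of a Haar function lies, up to a null set, in a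
single quadrant, so its integral over every quadrant vanishes; and `HA` is closed because the atomic
norm dominates the `L¹` norm.

For the other, let `f` be in `HA`. Cutting off an atomic decomposition gives a bounded, boundedly
supported `g` of mean zero, close to `f` in `H¹`. Its quadrant integrals are small and add up to
zero, so a combination `h` of the indicators of the four unit squares at the origin has the same
quadrant integrals and small atomic norm (`exists_quadrant_correction`). Put `b = g - h`. The
support of `b` lies in four large dyadic squares meeting at the origin, one per quadrant, so `b` has
mean zero on every dyadic square of that generation `n`. This is where the quadrant condition is
used: no dyadic square, however large, crosses an axis.

The average `E_{n+i} b` over dyadic squares of generation `n + i` is then a finite Haar sum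
(`exists_mem_haarSpan_eq_dyadicMean`), and `b - E_{n+i} b` tends to zero in `L¹`, with uniform
bounds on size and support. The crux is to turn this into convergence in the atomic norm. By
`exists_mem_atomicSums_le`, a Calderón–Zygmund decomposition at height `l` splits a function bounded
by `M` on a square of side `s` into a good part bounded by `4 l`, which costs `4 l s²`, and a bad
part on stopping squares of total area at most `‖g‖₁ / l`, which costs `2 M ‖g‖₁ / l`. Fixing a
small `l` first and then letting the `L¹` norm tend to zero makes both terms small. -/

/-! ### Dyadic squares and their nesting -/

/-- The index of the dyadic square of side `2⁻ⁿ` containing `p`. -/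
def dyadicIdx (n : ℤ) (p : ℝ × ℝ) : ℤ × ℤ := (⌊(2 : ℝ) ^ n * p.1⌋, ⌊(2 : ℝ) ^ n * p.2⌋)

/-- The half-open dyadic square of side `2⁻ⁿ` with index `κ`. -/
def dyadic (n : ℤ) (κ : ℤ × ℤ) : Set (ℝ × ℝ) := {p | dyadicIdx n p = κ}

lemma mem_dyadic {n : ℤ} {κ : ℤ × ℤ} {p : ℝ × ℝ} : p ∈ dyadic n κ ↔ dyadicIdx n p = κ := Iff.rfl

lemma mem_dyadic_self (n : ℤ) (p : ℝ × ℝ) : p ∈ dyadic n (dyadicIdx n p) := rfl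

lemma floor_two_zpow_mul (n m : ℤ) (x : ℝ) :
    ⌊(2 : ℝ) ^ n * x⌋ = m ↔
      x ∈ Ico (m * (2 : ℝ) ^ (-n)) (m * (2 : ℝ) ^ (-n) + (2 : ℝ) ^ (-n)) := by
  have h2 : (0 : ℝ) < 2 ^ n := by positivity
  rw [Int.floor_eq_iff, zpow_neg, mem_Ico, ← add_one_mul, ← div_eq_mul_inv, ← div_eq_mul_inv,
    div_le_iff₀ h2, lt_div_iff₀ h2, mul_comm x]

/-- The lower left corner of a dyadic square. -/
def corner (n : ℤ) (κ : ℤ × ℤ) : ℝ × ℝ := (κ.1 * (2 : ℝ) ^ (-n), κ.2 * (2 : ℝ) ^ (-n))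

lemma dyadic_eq (n : ℤ) (κ : ℤ × ℤ) :
    dyadic n κ = Ico (corner n κ).1 ((corner n κ).1 + (2 : ℝ) ^ (-n)) ×ˢ
      Ico (corner n κ).2 ((corner n κ).2 + (2 : ℝ) ^ (-n)) := by
  ext p
  simp only [mem_dyadic, dyadicIdx, Prod.ext_iff, floor_two_zpow_mul, mem_prod, corner]

lemma dyadic_subset_square (n : ℤ) (κ : ℤ × ℤ) :
    dyadic n κ ⊆ square (corner n κ) ((2 : ℝ) ^ (-n)) := by
  rw [dyadic_eq]
  exact prod_mono Ico_subset_Icc_self Ico_subset_Icc_self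

lemma dyadic_ae_eq_square (n : ℤ) (κ : ℤ × ℤ) :
    dyadic n κ =ᵐ[volume] square (corner n κ) ((2 : ℝ) ^ (-n)) := by
  rw [dyadic_eq, square, Measure.volume_eq_prod]
  exact Measure.set_prod_ae_eq Ico_ae_eq_Icc Ico_ae_eq_Icc

lemma measurableSet_dyadic (n : ℤ) (κ : ℤ × ℤ) : MeasurableSet (dyadic n κ) := by
  rw [dyadic_eq]; exact measurableSet_Ico.prod measurableSet_Ico

lemma volume_dyadic (n : ℤ) (κ : ℤ × ℤ) :
    volume (dyadic n κ) = ENNReal.ofReal (((2 : ℝ) ^ (-n)) ^ 2) := by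
  rw [measure_congr (dyadic_ae_eq_square n κ), volume_square _ (by positivity)]

lemma volume_real_dyadic (n : ℤ) (κ : ℤ × ℤ) :
    volume.real (dyadic n κ) = ((2 : ℝ) ^ (-n)) ^ 2 := by
  rw [measureReal_def, volume_dyadic, ENNReal.toReal_ofReal (by positivity)]

lemma volume_dyadic_lt_top (n : ℤ) (κ : ℤ × ℤ) : volume (dyadic n κ) < ⊤ := by
  rw [volume_dyadic]; exact ENNReal.ofReal_lt_top

/-- The index of the parent of a dyadic square. -/
def parent (κ : ℤ × ℤ) : ℤ × ℤ := (κ.1 / 2, κ.2 / 2)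

lemma parent_dyadicIdx (n : ℤ) (p : ℝ × ℝ) : parent (dyadicIdx (n + 1) p) = dyadicIdx n p := by
  have key : ∀ x : ℝ, ⌊(2 : ℝ) ^ (n + 1) * x⌋ / 2 = ⌊(2 : ℝ) ^ n * x⌋ := fun x => by
    have := Int.mul_cast_floor_div_cancel_of_pos (n := 2) two_pos ((2 : ℝ) ^ n * x)
    rw [← this, zpow_add_one₀ two_ne_zero]
    congr 2
    push_cast; ring
  simp only [parent, dyadicIdx, key]

/-- Dyadic squares are nested: the index at a coarser generation is obtained from a finer one by
iterating `parent`. -/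
lemma dyadicIdx_eq_of_le {n m : ℤ} (h : n ≤ m) {p q : ℝ × ℝ}
    (hpq : dyadicIdx m p = dyadicIdx m q) : dyadicIdx n p = dyadicIdx n q := by
  induction m, h using Int.leInduction with
  | base => exact hpq
  | succ m _ ih => exact ih (by rw [← parent_dyadicIdx, hpq, parent_dyadicIdx])

lemma dyadic_nonempty (n : ℤ) (κ : ℤ × ℤ) : (dyadic n κ).Nonempty := by
  refine ⟨corner n κ, ?_⟩
  rw [dyadic_eq]
  have : (0 : ℝ) < 2 ^ (-n) := by positivity
  exact ⟨⟨le_rfl, by linarith⟩, le_rfl, by linarith⟩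

/-! ### Dyadic averages and Lebesgue differentiation -/

section mean

variable {E : Type*} [NormedAddCommGroup E] [NormedSpace ℝ E]

/-- The average of `f` over the dyadic square of side `2⁻ⁿ` containing `p`. -/
def dyadicMean (n : ℤ) (f : ℝ × ℝ → E) (p : ℝ × ℝ) : E := ⨍ x in dyadic n (dyadicIdx n p), f x

lemma dyadicMean_of_mem {n : ℤ} {κ : ℤ × ℤ} {p : ℝ × ℝ} (hp : p ∈ dyadic n κ) (f : ℝ × ℝ → E) :
    dyadicMean n f p = ⨍ x in dyadic n κ, f x := by
  rw [dyadicMean, mem_dyadic.1 hp]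

lemma setIntegral_dyadic_eq (n : ℤ) (κ : ℤ × ℤ) (f : ℝ × ℝ → E) :
    ∫ x in dyadic n κ, f x = (((2 : ℝ) ^ (-n)) ^ 2) • ⨍ x in dyadic n κ, f x := by
  rw [setAverage_eq, volume_real_dyadic, smul_inv_smul₀ (by positivity)]

lemma norm_setAverage_dyadic_le {n : ℤ} {κ : ℤ × ℤ} {f : ℝ × ℝ → E} {M : ℝ}
    (hf : ∀ᵐ x, ‖f x‖ ≤ M) : ‖⨍ x in dyadic n κ, f x‖ ≤ M := by
  have h := norm_setIntegral_le_of_norm_le_const_ae (volume_dyadic_lt_top n κ)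
    (ae_restrict_of_ae hf)
  rw [volume_real_dyadic, setIntegral_dyadic_eq, norm_smul, Real.norm_of_nonneg (by positivity),
    mul_comm] at h
  exact le_of_mul_le_mul_right h (by positivity)

lemma setAverage_dyadic_eq_zero {n : ℤ} {κ : ℤ × ℤ} {f : ℝ × ℝ → E}
    (h : ∀ᵐ x, x ∈ dyadic n κ → f x = 0) : ⨍ x in dyadic n κ, f x = 0 := by
  rw [setAverage_congr_fun (measurableSet_dyadic n κ) h]
  simp

lemma setIntegral_dyadic_dyadicMean [CompleteSpace E] (n : ℤ) (κ : ℤ × ℤ) (f : ℝ × ℝ → E) :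
    ∫ x in dyadic n κ, dyadicMean n f x = ∫ x in dyadic n κ, f x := by
  rw [setIntegral_congr_fun (measurableSet_dyadic n κ)
    (g := fun _ => ⨍ x in dyadic n κ, f x) (fun p hp => dyadicMean_of_mem hp f),
    setIntegral_const, volume_real_dyadic, ← setIntegral_dyadic_eq]

/-- Lebesgue differentiation for a doubling measure: in the sup metric of the plane the closed
dyadic squares are balls, which shrink to `p` without being centred at it. -/
lemma ae_tendsto_dyadicMean [CompleteSpace E] (n : ℤ) {f : ℝ × ℝ → E}
    (hf : LocallyIntegrable f) :
    ∀ᵐ p, Tendsto (fun i : ℕ => dyadicMean (n + i) f p) atTop (𝓝 (f p)) := by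
  filter_upwards [IsUnifLocDoublingMeasure.ae_tendsto_average volume hf 1] with p hp
  -- Radius and centre of the closed dyadic square around `p`, seen as a ball.
  set r : ℕ → ℝ := fun i => (2 : ℝ) ^ (-(n + i)) / 2 with hr
  set w : ℕ → ℝ × ℝ := fun i => corner (n + i) (dyadicIdx (n + i) p) + (r i, r i) with hw
  have hball : ∀ i, Metric.closedBall (w i) (r i) =
      square (corner (n + i) (dyadicIdx (n + i) p)) ((2 : ℝ) ^ (-(n + i))) := fun i => by
    rw [← closedBall_prod_same, Real.closedBall_eq_Icc, Real.closedBall_eq_Icc, square]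
    simp only [hr, Prod.fst_add, Prod.snd_add]
    congr 2 <;> ring
  have hlim : Tendsto r atTop (𝓝[>] 0) := by
    refine tendsto_nhdsWithin_iff.2 ⟨?_, Eventually.of_forall fun i => by
      simp only [hr, mem_Ioi]; positivity⟩
    have h1 := (tendsto_pow_atTop_nhds_zero_of_lt_one (r := (1 / 2 : ℝ)) (by norm_num)
      (by norm_num)).const_mul ((2 : ℝ) ^ (-n) / 2)
    rw [mul_zero] at h1
    refine h1.congr fun i => ?_
    simp only [hr, neg_add, zpow_add₀ (two_ne_zero' ℝ), zpow_neg, zpow_natCast, one_div, inv_pow]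
    ring
  have h := hp w r hlim (Eventually.of_forall fun i => by
    rw [one_mul, hball]; exact dyadic_subset_square _ _ (mem_dyadic_self _ _))
  refine h.congr fun i => ?_
  rw [hball, dyadicMean]
  exact setAverage_congr (dyadic_ae_eq_square _ _).symm

end mean

/-- The parent square has four times the area and a larger integral. This gives the 4 in the bound
for the good part. -/
lemma dyadicMean_norm_succ_le {F : Type*} [NormedAddCommGroup F] {n : ℤ} {f : ℝ × ℝ → F}
    (hf : Integrable f) (p : ℝ × ℝ) :
    dyadicMean (n + 1) (fun x => ‖f x‖) p ≤ 4 * dyadicMean n (fun x => ‖f x‖) p := by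
  have hsub : dyadic (n + 1) (dyadicIdx (n + 1) p) ⊆ dyadic n (dyadicIdx n p) := fun q hq =>
    dyadicIdx_eq_of_le (by omega) hq
  have h := setIntegral_mono_set hf.norm.integrableOn
    (Eventually.of_forall fun x => norm_nonneg (f x)) hsub.eventuallyLE
  rw [setIntegral_dyadic_eq, setIntegral_dyadic_eq, smul_eq_mul, smul_eq_mul] at h
  have e : ((2 : ℝ) ^ (-n)) ^ 2 = 4 * ((2 : ℝ) ^ (-(n + 1))) ^ 2 := by
    rw [show -n = -(n + 1) + 1 by ring, zpow_add_one₀ two_ne_zero]; ring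
  rw [e, mul_comm 4, mul_assoc] at h
  exact le_of_mul_le_mul_left h (by positivity)

/-! ### Construction of atomic decompositions -/

section atomic

variable {𝕜 : Type*} [RCLike 𝕜]

/-- Pads a countable family by zero atoms to a sequence, so that families indexed by stopping
squares, possibly finite, can be used. -/
lemma tsum_mem_atomicSums {ι : Type*} [Countable ι] {coeff : ι → 𝕜}
    {a : ι → Lp 𝕜 1 (volume : Measure (ℝ × ℝ))} {f : Lp 𝕜 1 (volume : Measure (ℝ × ℝ))}
    (ha : ∀ i, IsAtom (a i)) (hc : Summable fun i => ‖coeff i‖)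
    (hf : HasSum (fun i => coeff i • a i) f) : ∑' i, ‖coeff i‖ ∈ atomicSums f := by
  obtain ⟨e, he⟩ := Countable.exists_injective_nat ι
  have h1 : (fun j => ‖Function.extend e coeff 0 j‖) =
      Function.extend e (fun i => ‖coeff i‖) 0 := by
    ext j
    by_cases hj : ∃ i, e i = j
    · obtain ⟨i, rfl⟩ := hj
      simp [he.extend_apply]
    · simp [Function.extend_apply' _ _ _ hj]
  have h2 : (fun j => Function.extend e coeff 0 j • Function.extend e a 0 j) =
      Function.extend e (fun i => coeff i • a i) 0 := by
    ext1 j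
    by_cases hj : ∃ i, e i = j
    · obtain ⟨i, rfl⟩ := hj
      simp [he.extend_apply]
    · simp [Function.extend_apply' _ _ _ hj]
  refine ⟨Function.extend e coeff 0, Function.extend e a 0, ⟨fun j => ?_, ?_, ?_⟩, ?_⟩
  · by_cases hj : ∃ i, e i = j
    · obtain ⟨i, rfl⟩ := hj
      simpa [he.extend_apply] using ha i
    · rw [Function.extend_apply' _ _ _ hj]
      exact isAtom_zero
  · rw [h1]; exact (summable_extend_zero he).2 hc
  · rw [h2]; exact (hasSum_extend_zero he).2 hf
  · rw [h1]; exact (((hasSum_extend_zero he).2 hc.hasSum).tsum_eq).symm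

/-- A bounded function with mean zero, supported in a square, is a multiple of an atom. -/
lemma exists_isAtom_smul {a : Lp 𝕜 1 (volume : Measure (ℝ × ℝ))} {c : ℝ × ℝ} {s K : ℝ}
    (hs : 0 < s) (hK : 0 ≤ K) (h0 : ∀ᵐ x, x ∉ square c s → a x = 0) (hb : ∀ᵐ x, ‖a x‖ ≤ K)
    (hint : ∫ x, a x = 0) :
    ∃ a' : Lp 𝕜 1 (volume : Measure (ℝ × ℝ)), IsAtom a' ∧ a = ((K * s ^ 2 : ℝ) : 𝕜) • a' := by
  rcases hK.eq_or_lt with rfl | hK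
  · refine ⟨0, isAtom_zero, ?_⟩
    rw [smul_zero, Lp.eq_zero_iff_ae_eq_zero]
    filter_upwards [hb] with x hx using norm_le_zero_iff.1 hx
  · have hpos : 0 < K * s ^ 2 := by positivity
    have hne : ((K * s ^ 2 : ℝ) : 𝕜) ≠ 0 := RCLike.ofReal_ne_zero.2 hpos.ne'
    have hae := Lp.coeFn_smul (((K * s ^ 2 : ℝ) : 𝕜)⁻¹) a
    have hz : ∀ᵐ x, x ∉ square c s → (((K * s ^ 2 : ℝ) : 𝕜)⁻¹ • a) x = 0 := by
      filter_upwards [hae, h0] with x h1 h2 hx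
      rw [h1, Pi.smul_apply, h2 hx, smul_zero]
    refine ⟨((K * s ^ 2 : ℝ) : 𝕜)⁻¹ • a, ⟨c, s, hs, hz, ?_, ?_⟩, (smul_inv_smul₀ hne a).symm⟩
    · filter_upwards [hae, hb] with x h1 h2
      rw [h1, Pi.smul_apply, norm_smul, norm_inv, RCLike.norm_ofReal, abs_of_pos hpos]
      calc (K * s ^ 2)⁻¹ * ‖a x‖ ≤ (K * s ^ 2)⁻¹ * K := by gcongr
        _ = 1 / s ^ 2 := by field_simp
    · rw [setIntegral_eq_integral_of_ae_compl_eq_zero hz, integral_congr_ae hae]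
      simp only [Pi.smul_apply]
      rw [integral_smul, hint, smul_zero]

lemma mem_atomicSums_of_bounded {a : Lp 𝕜 1 (volume : Measure (ℝ × ℝ))} {c : ℝ × ℝ} {s K : ℝ}
    (hs : 0 < s) (hK : 0 ≤ K) (h0 : ∀ᵐ x, x ∉ square c s → a x = 0) (hb : ∀ᵐ x, ‖a x‖ ≤ K)
    (hint : ∫ x, a x = 0) : K * s ^ 2 ∈ atomicSums a := by
  obtain ⟨a', ha', h⟩ := exists_isAtom_smul hs hK h0 hb hint
  have := tsum_mem_atomicSums (ι := Unit) (coeff := fun _ => ((K * s ^ 2 : ℝ) : 𝕜))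
    (a := fun _ => a') (f := a) (fun _ => ha') Summable.of_finite (by
      rw [h]; exact hasSum_unique _)
  simpa [abs_of_nonneg hK, -map_mul] using this

/-- A series of functions with disjoint supports and an integrable common bound
converges in `L¹`. -/
lemma hasSum_toLp_of_disjoint {ι X : Type*} [Countable ι] [MeasurableSpace X] {μ : Measure X}
    {q : ι → Set X} (hd : Pairwise (Function.onFun Disjoint q)) {u : ι → X → 𝕜}
    (hu : ∀ i, MemLp (u i) 1 μ) (hq : ∀ i, ∀ x ∉ q i, u i x = 0) {G : X → ℝ}
    (hG : Integrable G μ) (huG : ∀ᵐ x ∂μ, ∀ i, ‖u i x‖ ≤ G x) {B : X → 𝕜}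
    (hB : ∀ i, ∀ x ∈ q i, B x = u i x) (hB0 : ∀ x, (∀ i, x ∉ q i) → B x = 0) :
    ∃ h : MemLp B 1 μ, HasSum (fun i => (hu i).toLp) h.toLp := by
  classical
  have hsum : ∀ x, HasSum (fun i => u i x) (B x) := fun x => by
    by_cases hx : ∃ i, x ∈ q i
    · obtain ⟨i, hi⟩ := hx
      rw [hB i x hi]
      exact hasSum_single i fun j hj => hq j x fun h => (hd hj).le_bot ⟨h, hi⟩
    · push Not at hx
      rw [hB0 x hx]
      simp only [hq _ x (hx _)]
      exact hasSum_zero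
  have hpart : ∀ (F : Finset ι) (x : X), (∀ i, ‖u i x‖ ≤ G x) → (∃ i, x ∈ q i) →
      ‖∑ i ∈ F, u i x‖ ≤ G x ∧ ‖B x‖ ≤ G x := fun F x hx ⟨i, hi⟩ => by
    have h0 : 0 ≤ G x := (norm_nonneg _).trans (hx i)
    refine ⟨?_, by rw [hB i x hi]; exact hx i⟩
    have hz : ∀ j ∈ F, j ≠ i → u j x = 0 := fun j _ hj =>
      hq j x fun h => (hd hj).le_bot ⟨h, hi⟩
    by_cases hiF : i ∈ F
    · rw [Finset.sum_eq_single_of_mem i hiF hz]; exact hx i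
    · rw [Finset.sum_eq_zero fun j hj => hz j hj (fun h => hiF (h ▸ hj)), norm_zero]; exact h0
  have hdiff : ∀ F : Finset ι, ∀ᵐ x ∂μ, ‖∑ i ∈ F, u i x - B x‖ ≤ 2 * |G x| := fun F => by
    filter_upwards [huG] with x hx
    by_cases hxq : ∃ i, x ∈ q i
    · have h := hpart F x hx hxq
      have := norm_sub_le (∑ i ∈ F, u i x) (B x)
      linarith [le_abs_self (G x)]
    · push Not at hxq
      rw [hB0 x hxq, Finset.sum_eq_zero fun i _ => hq i x (hxq i)]
      simp
  have hmeas : AEStronglyMeasurable B μ :=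
    aestronglyMeasurable_of_tendsto_ae (atTop : Filter (Finset ι))
      (f := fun F x => ∑ i ∈ F, u i x)
      (fun F => Finset.aestronglyMeasurable_fun_sum F fun i _ => (hu i).aestronglyMeasurable)
      (Eventually.of_forall hsum)
  have hBi : Integrable B μ := by
    refine (hG.abs.const_mul 2).mono' hmeas ?_
    filter_upwards [hdiff ∅] with x hx
    simpa using hx
  refine ⟨memLp_one_iff_integrable.2 hBi, ?_⟩
  rw [HasSum, SummationFilter.unconditional_filter, tendsto_iff_norm_sub_tendsto_zero]
  have hnorm : ∀ F : Finset ι, ‖∑ i ∈ F, (hu i).toLp - (memLp_one_iff_integrable.2 hBi).toLp‖ =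
      ∫ x, ‖∑ i ∈ F, u i x - B x‖ ∂μ := fun F => by
    rw [L1.norm_eq_integral_norm]
    refine integral_congr_ae ?_
    have h3 : ∀ᵐ x ∂μ, ∀ i ∈ F, (hu i).toLp (u i) x = u i x :=
      (ae_ball_iff F.countable_toSet).2 fun i _ => (hu i).coeFn_toLp
    filter_upwards [Lp.coeFn_sub (∑ i ∈ F, (hu i).toLp) (memLp_one_iff_integrable.2 hBi).toLp,
      Lp.coeFn_finsetSum F (fun i => (hu i).toLp), h3,
      (memLp_one_iff_integrable.2 hBi).coeFn_toLp] with x h1 h2 h3 h4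
    rw [h1, Pi.sub_apply, h2, h4, Finset.sum_apply, Finset.sum_congr rfl h3]
  simp only [hnorm]
  -- The finite subsets of a countable set form a countably generated filter, so dominated
  -- convergence applies to unordered sums.
  have := tendsto_integral_filter_of_dominated_convergence (μ := μ)
    (l := (atTop : Filter (Finset ι))) (F := fun F x => ‖∑ i ∈ F, u i x - B x‖)
    (f := fun _ => 0) (fun x => 2 * |G x|)
    (Eventually.of_forall fun F => ((Finset.aestronglyMeasurable_fun_sum F fun i _ =>
      (hu i).aestronglyMeasurable).sub hmeas).norm)
    (Eventually.of_forall fun F => by simpa using hdiff F) (hG.abs.const_mul 2)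
    (Eventually.of_forall fun x => by
      have := (tendsto_iff_norm_sub_tendsto_zero.1 (hsum x))
      exact this)
  simpa using this

end atomic

/-! ### Stopping squares -/

section stopping

/-- The dyadic averages of `v` exceed `l` for the first time at generation `n + i`. -/
def Stops (n : ℤ) (v : ℝ × ℝ → ℝ) (l : ℝ) (i : ℕ) (p : ℝ × ℝ) : Prop :=
  l < dyadicMean (n + i) v p ∧ ∀ j < i, dyadicMean (n + j) v p ≤ l

/-- The indices of the maximal dyadic squares on which the average of `v` exceeds `l`. -/
def stopIdx (n : ℤ) (v : ℝ × ℝ → ℝ) (l : ℝ) : Set (ℕ × ℤ × ℤ) :=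
  {x | ∃ p ∈ dyadic (n + x.1) x.2, Stops n v l x.1 p}

/-- The maximal dyadic squares on which the average of `v` exceeds `l`. -/
def stopSquare (n : ℤ) (v : ℝ × ℝ → ℝ) (l : ℝ) (x : stopIdx n v l) : Set (ℝ × ℝ) :=
  dyadic (n + x.1.1) x.1.2

variable {n : ℤ} {v : ℝ × ℝ → ℝ} {l : ℝ}

/-- Stopping at generation `n + i` involves only the averages over the square of that generation and
its ancestors, so it is a property of the square. -/
lemma Stops.congr {i : ℕ} {p p' : ℝ × ℝ} (h : Stops n v l i p)
    (hp : dyadicIdx (n + i) p = dyadicIdx (n + i) p') : Stops n v l i p' := by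
  have key : ∀ j ≤ i, dyadicMean (n + j) v p' = dyadicMean (n + j) v p := fun j hj => by
    rw [dyadicMean, dyadicMean, dyadicIdx_eq_of_le (by omega) hp]
  exact ⟨by rw [key i le_rfl]; exact h.1, fun j hj => by rw [key j hj.le]; exact h.2 j hj⟩

lemma stops_of_mem_stopSquare {x : stopIdx n v l} {p : ℝ × ℝ} (hp : p ∈ stopSquare n v l x) :
    Stops n v l x.1.1 p := by
  obtain ⟨p', hp', h⟩ := x.2
  exact h.congr (hp'.trans hp.symm)

/-- A point has at most one first generation at which its average exceeds `l`, hence at most one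
stopping square. -/
lemma pairwise_disjoint_stopSquare :
    Pairwise (Function.onFun Disjoint (stopSquare n v l)) := by
  intro x y hxy
  refine Set.disjoint_left.2 fun p hx hy => hxy ?_
  have h1 := stops_of_mem_stopSquare hx
  have h2 := stops_of_mem_stopSquare hy
  have h3 : x.1.1 = y.1.1 := by
    rcases lt_trichotomy x.1.1 y.1.1 with h | h | h
    · exact absurd h1.1 (not_lt.2 (h2.2 _ h))
    · exact h
    · exact absurd h2.1 (not_lt.2 (h1.2 _ h))
  refine Subtype.ext (Prod.ext h3 ?_)
  have hx' : dyadicIdx (n + x.1.1) p = x.1.2 := hx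
  have hy' : dyadicIdx (n + y.1.1) p = y.1.2 := hy
  rw [← hx', ← hy', h3]

lemma dyadicMean_le_of_notMem_stopSquare {p : ℝ × ℝ} (hp : ∀ x, p ∉ stopSquare n v l x) (i : ℕ) :
    dyadicMean (n + i) v p ≤ l := by
  classical
  by_contra hi
  have hex : ∃ i : ℕ, l < dyadicMean (n + i) v p := ⟨i, not_le.1 hi⟩
  have hst : Stops n v l (Nat.find hex) p :=
    ⟨Nat.find_spec hex, fun j hj => not_lt.1 (Nat.find_min hex hj)⟩
  exact hp ⟨(Nat.find hex, dyadicIdx (n + Nat.find hex) p), p, mem_dyadic_self _ _, hst⟩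
    (mem_dyadic_self _ _)

/-- The weak type (1,1) estimate: each stopping square has area at most `1 / l` times the integral
of `v` over it, and the squares are disjoint. -/
lemma summable_volume_stopSquare (hv : Integrable v) (hv0 : 0 ≤ v) (hl : 0 < l) :
    Summable (fun x => volume.real (stopSquare n v l x)) ∧
      ∑' x, volume.real (stopSquare n v l x) ≤ (∫ x, v x) / l := by
  have hS := hasSum_integral_iUnion (μ := volume) (f := v) (s := stopSquare n v l)
    (fun x => measurableSet_dyadic _ _) pairwise_disjoint_stopSquare hv.integrableOn
  have hle : ∀ x, volume.real (stopSquare n v l x) ≤ (∫ p in stopSquare n v l x, v p) / l := by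
    intro x
    rw [le_div_iff₀ hl]
    obtain ⟨p, hp, h⟩ := x.2
    have h1 := h.1
    rw [dyadicMean_of_mem hp] at h1
    rw [stopSquare, setIntegral_dyadic_eq, volume_real_dyadic, smul_eq_mul]
    gcongr
  have hsum := Summable.of_nonneg_of_le (fun x => measureReal_nonneg) hle
    (hS.summable.div_const l)
  refine ⟨hsum, (hsum.tsum_le_tsum hle (hS.summable.div_const l)).trans ?_⟩
  rw [tsum_div_const, hS.tsum_eq]
  gcongr
  · exact Eventually.of_forall hv0
  · exact Measure.restrict_le_self

end stopping

/-! ### Calderón–Zygmund decomposition -/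

variable {𝕜 : Type*} [RCLike 𝕜]

/-- The integral over `A` as a continuous functional on `L¹(ℝ²)`. -/
def setIntegralL (𝕜 : Type*) [RCLike 𝕜] (A : Set (ℝ × ℝ)) :
    Lp 𝕜 1 (volume : Measure (ℝ × ℝ)) →L[𝕜] 𝕜 where
  toFun f := ∫ x in A, f x
  map_add' f g := by
    rw [integral_congr_ae (ae_restrict_of_ae (Lp.coeFn_add f g))]
    exact integral_add (L1.integrable_coeFn f).integrableOn (L1.integrable_coeFn g).integrableOn
  map_smul' c f := by
    rw [integral_congr_ae (ae_restrict_of_ae (Lp.coeFn_smul c f))]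
    exact integral_smul c _
  cont := continuous_setIntegral A

lemma setIntegralL_apply (A : Set (ℝ × ℝ)) (f : Lp 𝕜 1 (volume : Measure (ℝ × ℝ))) :
    setIntegralL 𝕜 A f = ∫ x in A, f x := rfl

lemma norm_setIntegralL_le (A : Set (ℝ × ℝ)) (f : Lp 𝕜 1 (volume : Measure (ℝ × ℝ))) :
    ‖setIntegralL 𝕜 A f‖ ≤ ‖f‖ := by
  rw [setIntegralL_apply, L1.norm_eq_integral_norm]
  exact (norm_integral_le_integral_norm _).trans
    (setIntegral_le_integral (L1.integrable_coeFn f).norm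
      (Eventually.of_forall fun x => norm_nonneg _))

lemma integral_eq_zero_of_dyadic {E : Type*} [NormedAddCommGroup E] [NormedSpace ℝ E]
    {g : ℝ × ℝ → E} (hg : Integrable g) (n : ℤ) (h : ∀ κ, ∫ x in dyadic n κ, g x = 0) :
    ∫ x, g x = 0 := by
  have hd : Pairwise (Function.onFun Disjoint (dyadic n)) := fun κ κ' hne =>
    Set.disjoint_left.2 fun p h1 h2 => hne (h1.symm.trans h2)
  have := hasSum_integral_iUnion (μ := volume) (f := g) (s := dyadic n)
    (measurableSet_dyadic n) hd hg.integrableOn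
  rw [show (⋃ κ, dyadic n κ) = univ from eq_univ_of_forall fun p =>
    mem_iUnion.2 ⟨_, mem_dyadic_self n p⟩, setIntegral_univ] at this
  simp only [h] at this
  exact this.unique hasSum_zero

/-- Calderón–Zygmund decomposition at height `l`: a bounded function with mean zero on all dyadic
squares of generation `n` has small atomic norm if its `L¹` norm is small. -/
theorem exists_mem_atomicSums_le {g : Lp 𝕜 1 (volume : Measure (ℝ × ℝ))} {n : ℤ} {c : ℝ × ℝ}
    {s M l : ℝ} (hs : 0 < s) (hM : 0 ≤ M) (hl : 0 < l) (hb : ∀ᵐ x, ‖g x‖ ≤ M)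
    {R : Set (ℝ × ℝ)} (hR : ∀ p q, dyadicIdx n p = dyadicIdx n q → p ∈ R → q ∈ R)
    (hRs : R ⊆ square c s) (h0 : ∀ᵐ x, x ∉ R → g x = 0)
    (hmean : ∀ κ, ∫ x in dyadic n κ, g x = 0) :
    ∃ r ∈ atomicSums g, r ≤ 4 * l * s ^ 2 + 2 * M * (‖g‖ / l) := by
  classical
  have hgi : Integrable g := L1.integrable_coeFn g
  set v : ℝ × ℝ → ℝ := fun x => ‖g x‖ with hv
  have hvi : Integrable v := hgi.norm
  obtain ⟨hsum, htsum⟩ := summable_volume_stopSquare (n := n) (l := l) hvi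
    (fun x => norm_nonneg (g x)) hl
  have hv_norm : ∫ x, v x = ‖g‖ := (L1.norm_eq_integral_norm g).symm
  set q := stopSquare n v l with hq
  have hqm : ∀ x, MeasurableSet (q x) := fun x => measurableSet_dyadic _ _
  -- `R` is a union of squares of generation `n`, so averages of `‖g‖` around a point off `R` are
  -- zero and cannot exceed `l`.
  have hqR : ∀ x, q x ⊆ R := fun x p hp => by
    by_contra hpR
    have h1 := (stops_of_mem_stopSquare hp).1
    have h2 : dyadicMean (n + x.1.1) v p = 0 := by
      refine setAverage_dyadic_eq_zero ?_
      filter_upwards [h0] with y hy hyp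
      rw [hv]
      simp only [norm_eq_zero]
      exact hy fun hyR => hpR (hR _ _ (dyadicIdx_eq_of_le (by omega) hyp) hyR)
    linarith
  have hRfin : volume (square c s) < ⊤ := by
    rw [volume_square _ hs]; exact ENNReal.ofReal_lt_top
  set m : stopIdx n v l → 𝕜 := fun x => ⨍ p in q x, g p with hm
  set u : stopIdx n v l → ℝ × ℝ → 𝕜 := fun x => (q x).indicator (fun p => g p - m x) with hu_def
  have hqfin : ∀ x, volume (q x) < ⊤ := fun x => volume_dyadic_lt_top _ _
  have hu : ∀ x, MemLp (u x) 1 volume := fun x => memLp_one_iff_integrable.2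
    ((integrable_indicator_iff (hqm x)).2
      (hgi.integrableOn.sub (integrableOn_const (hqfin x).ne)))
  have hmM : ∀ x, ‖m x‖ ≤ M := fun x => norm_setAverage_dyadic_le hb
  have hubound : ∀ᵐ p, ∀ x, ‖u x p‖ ≤ 2 * M := by
    filter_upwards [hb] with p hp x
    by_cases hpx : p ∈ q x
    · rw [hu_def]
      simp only [indicator_of_mem hpx]
      linarith [norm_sub_le (g p) (m x), hmM x]
    · rw [hu_def]
      simp only [indicator_of_notMem hpx, norm_zero]
      positivity
  have hG : Integrable ((square c s).indicator fun _ => 2 * M) :=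
    (integrable_indicator_iff (measurableSet_square c s)).2 (integrableOn_const hRfin.ne)
  have huG : ∀ᵐ p, ∀ x, ‖u x p‖ ≤ (square c s).indicator (fun _ => 2 * M) p := by
    filter_upwards [hubound] with p hp x
    by_cases hps : p ∈ square c s
    · rw [indicator_of_mem hps]; exact hp x
    · rw [indicator_of_notMem hps, hu_def]
      simp only [indicator_of_notMem (fun h => hps (hRs (hqR x h))), norm_zero, le_refl]
  -- The bad part: `g` minus its mean on each stopping square, zero elsewhere.
  set B : ℝ × ℝ → 𝕜 := fun p => if h : ∃ x, p ∈ q x then u h.choose p else 0 with hB_def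
  have hd : Pairwise (Function.onFun Disjoint q) := pairwise_disjoint_stopSquare
  have hB : ∀ x, ∀ p ∈ q x, B p = u x p := fun x p hp => by
    have hex : ∃ x, p ∈ q x := ⟨x, hp⟩
    have : hex.choose = x := by
      by_contra hne
      exact (hd hne).le_bot ⟨hex.choose_spec, hp⟩
    simp only [hB_def, dif_pos hex, this]
  have hB0 : ∀ p, (∀ x, p ∉ q x) → B p = 0 := fun p hp =>
    dif_neg (by push Not; exact hp)
  obtain ⟨hBL, hBsum⟩ := hasSum_toLp_of_disjoint hd hu
    (fun x p hp => indicator_of_notMem hp _) hG huG hB hB0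
  have huint : ∀ x, ∫ p, (hu x).toLp (u x) p = 0 := fun x => by
    rw [integral_congr_ae (hu x).coeFn_toLp]
    simp only [hu_def]
    rw [integral_indicator (hqm x), integral_sub hgi.integrableOn
      (integrableOn_const (hqfin x).ne), setIntegral_const]
    simp only [hm, hq, stopSquare]
    rw [volume_real_dyadic, setIntegral_dyadic_eq, sub_self]
  have hatom : ∀ x, ∃ a : Lp 𝕜 1 (volume : Measure (ℝ × ℝ)), IsAtom a ∧
      (hu x).toLp (u x) = ((2 * M * volume.real (q x) : ℝ) : 𝕜) • a := fun x => by
    rw [hq, stopSquare, volume_real_dyadic]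
    refine exists_isAtom_smul (c := corner (n + x.1.1) x.1.2) (by positivity) (by positivity)
      ?_ ?_ (huint x)
    · filter_upwards [(hu x).coeFn_toLp] with p hp hps
      rw [hp]
      exact indicator_of_notMem (fun h => hps (dyadic_subset_square _ _ h)) _
    · filter_upwards [(hu x).coeFn_toLp, hubound] with p hp hb
      rw [hp]; exact hb x
  choose a ha hua using hatom
  have hcoef : ∀ x, ‖((2 * M * volume.real (q x) : ℝ) : 𝕜)‖ = 2 * M * volume.real (q x) :=
    fun x => by rw [RCLike.norm_ofReal, abs_of_nonneg (by positivity)]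
  have hbad : ∑' x, 2 * M * volume.real (q x) ∈ atomicSums (hBL.toLp B) := by
    have := tsum_mem_atomicSums (coeff := fun x => ((2 * M * volume.real (q x) : ℝ) : 𝕜)) (a := a)
      (f := hBL.toLp B) ha (by simp only [hcoef]; exact hsum.mul_left _)
      (by simp only [← hua]; exact hBsum)
    simpa only [hcoef] using this
  have hBint : ∫ p, hBL.toLp B p = 0 := by
    have h := (setIntegralL 𝕜 univ).hasSum hBsum
    simp only [setIntegralL_apply, setIntegral_univ, huint] at h
    exact h.unique hasSum_zero
  have hsub := Lp.coeFn_sub g (hBL.toLp B)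
  have hgood : 4 * l * s ^ 2 ∈ atomicSums (g - hBL.toLp B) := by
    have hnot : ∀ p, p ∉ square c s → B p = 0 := fun p hp =>
      hB0 p fun x hx => hp (hRs (hqR x hx))
    refine mem_atomicSums_of_bounded (c := c) hs (by positivity) ?_ ?_ ?_
    · filter_upwards [hsub, hBL.coeFn_toLp, h0] with p h1 h2 h3 hp
      rw [h1, Pi.sub_apply, h2, hnot p hp, h3 fun h => hp (hRs h), sub_zero]
    · filter_upwards [hsub, hBL.coeFn_toLp, ae_tendsto_dyadicMean n hvi.locallyIntegrable]
        with p h1 h2 h3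
      rw [h1, Pi.sub_apply, h2]
      by_cases hp : ∃ x, p ∈ q x
      · obtain ⟨x, hx⟩ := hp
        rw [hB x p hx, hu_def]
        simp only [indicator_of_mem hx, sub_sub_cancel]
        have hst := stops_of_mem_stopSquare hx
        obtain ⟨⟨i, κ⟩, hxi⟩ := x
        -- On a stopping square the good part is the mean of `g`. At generation `n` no average over
        -- the parent is controlled, but there the mean of `g` is zero; later, the parent did not
        -- stop, which gives `4 l`.
        rcases i with _ | i
        · have : m ⟨(0, κ), hxi⟩ = 0 := by
            simp only [hm, hq, stopSquare, Nat.cast_zero, add_zero, setAverage_eq, hmean,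
              smul_zero]
          rw [this, norm_zero]; positivity
        · have h4 : ‖m ⟨(i + 1, κ), hxi⟩‖ ≤ dyadicMean (n + (i + 1 : ℕ)) v p := by
            rw [dyadicMean_of_mem hx]
            simp only [hm, hq, stopSquare, setAverage_eq, norm_smul, smul_eq_mul, norm_inv]
            rw [Real.norm_of_nonneg measureReal_nonneg]
            gcongr
            exact norm_integral_le_integral_norm _
          have h5 := dyadicMean_norm_succ_le (n := n + i) hgi p
          have h6 := hst.2 i (Nat.lt_succ_self i)
          push_cast at h4
          rw [← add_assoc] at h4
          linarith
      · push Not at hp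
        rw [hB0 p hp, sub_zero]
        -- Off the stopping squares all averages are at most `l`, and they converge to `‖g p‖`.
        have : v p ≤ l := le_of_tendsto h3
          (Eventually.of_forall (dyadicMean_le_of_notMem_stopSquare hp))
        simp only [hv] at this
        linarith
    · rw [integral_congr_ae hsub]
      simp only [Pi.sub_apply]
      rw [integral_sub hgi (L1.integrable_coeFn _), hBint, sub_zero]
      exact integral_eq_zero_of_dyadic hgi n hmean
  refine ⟨_, by simpa using add_mem_atomicSums hgood hbad, ?_⟩
  rw [tsum_mul_left]
  rw [hv_norm] at htsum
  gcongr

/-! ### Dyadic averages as finite Haar sums -/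

/-- The span of the Haar system, as a subspace of `L¹(ℝ²)`. -/
def haarSpan (𝕜 : Type*) [RCLike 𝕜] : Submodule 𝕜 (Lp 𝕜 1 (volume : Measure (ℝ × ℝ))) :=
  (Submodule.span 𝕜 (haarSystem 𝕜)).map H1.toL1

lemma toLp_haarFun_mem_haarSpan (j : Fin 3) (n k l : ℤ) :
    (memLp_haarFun 𝕜 j n k l).toLp ∈ haarSpan 𝕜 :=
  ⟨haar 𝕜 j n k l, Submodule.subset_span ⟨j, n, k, l, rfl⟩, rfl⟩

/-- The indicator function of a dyadic square, as an element of `L¹(ℝ²)`. -/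
def dyadicInd (𝕜 : Type*) [RCLike 𝕜] (n : ℤ) (κ : ℤ × ℤ) :
    Lp 𝕜 1 (volume : Measure (ℝ × ℝ)) :=
  indicatorConstLp 1 (measurableSet_dyadic n κ) (volume_dyadic_lt_top n κ).ne 1

lemma coeFn_dyadicInd (n : ℤ) (κ : ℤ × ℤ) :
    ∀ᵐ p, dyadicInd 𝕜 n κ p = if dyadicIdx n p = κ then 1 else 0 := by
  filter_upwards [indicatorConstLp_coeFn (μ := volume) (p := 1) (hs := measurableSet_dyadic n κ)
    (hμs := (volume_dyadic_lt_top n κ).ne) (c := (1 : 𝕜))] with p hp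
  rw [dyadicInd, hp]
  by_cases h : dyadicIdx n p = κ
  · rw [if_pos h, indicator_of_mem (mem_dyadic.2 h)]
  · rw [if_neg h, indicator_of_notMem (fun h' => h (mem_dyadic.1 h'))]

/-- `chi` is the indicator of a closed interval and dyadic intervals are half-open; the excluded
right end point is the only discrepancy. -/
lemma ite_floor_eq_chi {t : ℝ} {k : ℤ} (h : t - k ≠ 1) :
    (if ⌊t⌋ = k then (1 : ℝ) else 0) = chi (t - k) := by
  have h' : ⌊t⌋ = k ↔ t - k ∈ Icc (0 : ℝ) 1 := by
    rw [Int.floor_eq_iff, mem_Icc, sub_nonneg]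
    refine and_congr_right fun _ => ⟨fun h1 => by linarith, fun h1 => ?_⟩
    have := lt_of_le_of_ne h1 h
    linarith
  by_cases hk : ⌊t⌋ = k
  · rw [if_pos hk, chi, indicator_of_mem (h'.1 hk), Pi.one_apply]
  · rw [if_neg hk, chi, indicator_of_notMem (fun h1 => hk (h'.2 h1))]

/-- A half of a dyadic interval has indicator `(chi ± haarH) / 2`, with plus for the left half (`m`
even) and minus for the right. -/
lemma exists_ite_floor_eq (m : ℤ) : ∃ σ : ℝ, ∀ t : ℝ, t - (m / 2 : ℤ) ≠ 1 →
    (if ⌊2 * t⌋ = m then (1 : ℝ) else 0) =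
      (chi (t - (m / 2 : ℤ)) + σ * haarH (t - (m / 2 : ℤ))) / 2 := by
  classical
  obtain ⟨k, hk⟩ : ∃ k, k = m / 2 := ⟨_, rfl⟩
  rw [← hk]
  rcases Int.emod_two_eq_zero_or_one m with h | h
  · have hm : m = 2 * k := by omega
    refine ⟨1, fun t ht => ?_⟩
    have h1 : ⌊2 * t⌋ = m ↔ 0 ≤ t - k ∧ t - k < 1 / 2 := by
      rw [Int.floor_eq_iff, hm]
      push_cast
      constructor <;> rintro ⟨h1, h2⟩ <;> constructor <;> linarith
    simp only [h1, chi, haarH, indicator_apply, mem_Icc, mem_Ico, Pi.one_apply]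
    generalize t - (k : ℝ) = z at ht ⊢
    rcases lt_or_gt_of_ne ht with ht | ht <;> split_ifs <;> first | (norm_num; done) | grind
  · have hm : m = 2 * k + 1 := by omega
    refine ⟨-1, fun t ht => ?_⟩
    have h1 : ⌊2 * t⌋ = m ↔ 1 / 2 ≤ t - k ∧ t - k < 1 := by
      rw [Int.floor_eq_iff, hm]
      push_cast
      constructor <;> rintro ⟨h1, h2⟩ <;> constructor <;> linarith
    simp only [h1, chi, haarH, indicator_apply, mem_Icc, mem_Ico, Pi.one_apply]
    generalize t - (k : ℝ) = z at ht ⊢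
    rcases lt_or_gt_of_ne ht with ht | ht <;> split_ifs <;> first | (norm_num; done) | grind

lemma ite_dyadicIdx_eq (n : ℤ) (κ : ℤ × ℤ) (p : ℝ × ℝ) :
    (if dyadicIdx n p = κ then (1 : 𝕜) else 0) =
      (((if ⌊(2 : ℝ) ^ n * p.1⌋ = κ.1 then (1 : ℝ) else 0) *
        (if ⌊(2 : ℝ) ^ n * p.2⌋ = κ.2 then (1 : ℝ) else 0) : ℝ) : 𝕜) := by
  simp only [dyadicIdx, Prod.ext_iff, ite_and]
  split_ifs <;> simp

lemma ae_two_zpow_mul_sub_ne (n k l : ℤ) :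
    ∀ᵐ p : ℝ × ℝ, (2 : ℝ) ^ n * p.1 - k ≠ 1 ∧ (2 : ℝ) ^ n * p.2 - l ≠ 1 := by
  have key : ∀ k : ℤ, ∀ᵐ x : ℝ, (2 : ℝ) ^ n * x - k ≠ 1 := fun k => by
    filter_upwards [Measure.ae_ne volume (((2 : ℝ) ^ n)⁻¹ * (k + 1))] with x hx h
    refine hx ?_
    rw [← sub_eq_iff_eq_add'.1 h, inv_mul_cancel_left₀ (by positivity)]
  rw [Measure.volume_eq_prod]
  filter_upwards [Measure.quasiMeasurePreserving_fst.ae (key k),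
    Measure.quasiMeasurePreserving_snd.ae (key l)] with p h1 h2 using ⟨h1, h2⟩

/-- Multiplying out `(X + σ U) (Y + τ V) / 4`, with `X`, `Y` from `chi` and `U`, `V` from `haarH`,
leaves `X Y / 4`, a quarter of the parent's indicator, plus multiples of the three Haar functions on
the parent. -/
lemma dyadicInd_sub_parent_mem (n : ℤ) (κ : ℤ × ℤ) :
    dyadicInd 𝕜 (n + 1) κ - (4 : 𝕜)⁻¹ • dyadicInd 𝕜 n (parent κ) ∈ haarSpan 𝕜 := by
  classical
  obtain ⟨σ, hσ⟩ := exists_ite_floor_eq κ.1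
  obtain ⟨τ, hτ⟩ := exists_ite_floor_eq κ.2
  set k : ℤ := κ.1 / 2 with hk
  set l : ℤ := κ.2 / 2 with hl
  -- The inverse power undoes the factor `2ⁿ` in `haarFun`.
  set a : ℝ := ((2 : ℝ) ^ n)⁻¹ / 4 with ha
  set F : Fin 3 → Lp 𝕜 1 (volume : Measure (ℝ × ℝ)) := fun j => (memLp_haarFun 𝕜 j n k l).toLp
    with hF
  have hFmem : ∀ j, F j ∈ haarSpan 𝕜 := fun j => toLp_haarFun_mem_haarSpan j n k l
  have hmem : ((a * σ : ℝ) : 𝕜) • F 0 + ((a * τ : ℝ) : 𝕜) • F 1 + ((a * (σ * τ) : ℝ) : 𝕜) • F 2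
      ∈ haarSpan 𝕜 :=
    add_mem (add_mem (Submodule.smul_mem _ _ (hFmem 0)) (Submodule.smul_mem _ _ (hFmem 1)))
      (Submodule.smul_mem _ _ (hFmem 2))
  convert hmem using 1
  refine Lp.ext ?_
  filter_upwards [Lp.coeFn_sub (dyadicInd 𝕜 (n + 1) κ) ((4 : 𝕜)⁻¹ • dyadicInd 𝕜 n (parent κ)),
    Lp.coeFn_smul (4 : 𝕜)⁻¹ (dyadicInd 𝕜 n (parent κ)), coeFn_dyadicInd (𝕜 := 𝕜) (n + 1) κ,
    coeFn_dyadicInd (𝕜 := 𝕜) n (parent κ),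
    Lp.coeFn_add (((a * σ : ℝ) : 𝕜) • F 0 + ((a * τ : ℝ) : 𝕜) • F 1)
      (((a * (σ * τ) : ℝ) : 𝕜) • F 2),
    Lp.coeFn_add (((a * σ : ℝ) : 𝕜) • F 0) (((a * τ : ℝ) : 𝕜) • F 1),
    Lp.coeFn_smul ((a * σ : ℝ) : 𝕜) (F 0), Lp.coeFn_smul ((a * τ : ℝ) : 𝕜) (F 1),
    Lp.coeFn_smul ((a * (σ * τ) : ℝ) : 𝕜) (F 2),
    (memLp_haarFun 𝕜 0 n k l).coeFn_toLp, (memLp_haarFun 𝕜 1 n k l).coeFn_toLp,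
    (memLp_haarFun 𝕜 2 n k l).coeFn_toLp, ae_two_zpow_mul_sub_ne n k l]
    with p h1 h2 h3 h4 h5 h6 h7 h8 h9 hf0 hf1 hf2 hne
  rw [h1, Pi.sub_apply, h2, Pi.smul_apply, h3, h4, h5, Pi.add_apply, h6, Pi.add_apply, h7, h8, h9]
  simp only [Pi.smul_apply, hF]
  rw [hf0, hf1, hf2]
  have e1 := hσ _ hne.1
  have e2 := hτ _ hne.2
  have e3 := ite_floor_eq_chi hne.1
  have e4 := ite_floor_eq_chi hne.2
  have e : ∀ x : ℝ, (2 : ℝ) ^ (n + 1) * x = 2 * ((2 : ℝ) ^ n * x) := fun x => by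
    rw [zpow_add_one₀ two_ne_zero]; ring
  rw [ite_dyadicIdx_eq, ite_dyadicIdx_eq, e, e, e1, e2, parent, ← hk, ← hl, e3, e4]
  simp only [haarFun, Psi, Matrix.cons_val_zero, Matrix.cons_val_one, Matrix.cons_val, smul_eq_mul]
  have h2n : (2 : ℝ) ^ n ≠ 0 := by positivity
  generalize chi ((2 : ℝ) ^ n * p.1 - k) = X
  generalize chi ((2 : ℝ) ^ n * p.2 - l) = Y
  generalize haarH ((2 : ℝ) ^ n * p.1 - k) = U
  generalize haarH ((2 : ℝ) ^ n * p.2 - l) = V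
  rw [show (4 : 𝕜)⁻¹ = (((4 : ℝ)⁻¹ : ℝ) : 𝕜) by push_cast; rfl]
  simp only [← RCLike.ofReal_mul, ← RCLike.ofReal_add, ← RCLike.ofReal_sub]
  congr 1
  rw [ha]
  generalize (2 : ℝ) ^ n = z at h2n ⊢
  field_simp
  ring

lemma dyadicInd_sub_ancestor_mem (n : ℤ) (p : ℝ × ℝ) (i : ℕ) :
    dyadicInd 𝕜 (n + i) (dyadicIdx (n + i) p) -
      ((4 : 𝕜)⁻¹ ^ i) • dyadicInd 𝕜 n (dyadicIdx n p) ∈ haarSpan 𝕜 := by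
  induction i with
  | zero => simp
  | succ i ih =>
    have h := dyadicInd_sub_parent_mem (𝕜 := 𝕜) (n + i) (dyadicIdx (n + i + 1) p)
    rw [parent_dyadicIdx] at h
    have h2 := add_mem h (Submodule.smul_mem _ (4 : 𝕜)⁻¹ ih)
    rw [smul_sub, smul_smul, ← pow_succ', sub_add_sub_cancel] at h2
    push_cast
    rwa [← add_assoc]

/-- The dyadic averages of a function of bounded support with mean zero on the dyadic squares of
some generation are finite linear combinations of Haar functions. -/
lemma exists_mem_haarSpan_eq_dyadicMean {b : ℝ × ℝ → 𝕜} (hb : Integrable b) {n : ℤ}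
    {R : Set (ℝ × ℝ)} (hR : Bornology.IsBounded R) (h0 : ∀ᵐ x, x ∉ R → b x = 0)
    (hmean : ∀ κ, ∫ x in dyadic n κ, b x = 0) (i : ℕ) :
    ∃ w ∈ haarSpan 𝕜, w =ᵐ[volume] dyadicMean (n + i) b := by
  classical
  have hfin : (dyadicIdx (n + i) '' R).Finite := by
    obtain ⟨r, hr⟩ := hR.subset_closedBall 0
    refine (Set.Finite.prod (Set.finite_Icc ⌊(2 : ℝ) ^ (n + i) * (-r)⌋ ⌊(2 : ℝ) ^ (n + i) * r⌋)
      (Set.finite_Icc ⌊(2 : ℝ) ^ (n + i) * (-r)⌋ ⌊(2 : ℝ) ^ (n + i) * r⌋)).subset ?_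
    rintro _ ⟨p, hp, rfl⟩
    have h := hr hp
    rw [mem_closedBall_zero_iff, Prod.norm_def, max_le_iff, Real.norm_eq_abs, Real.norm_eq_abs,
      abs_le, abs_le] at h
    obtain ⟨⟨h1, h2⟩, h3, h4⟩ := h
    refine ⟨⟨?_, ?_⟩, ?_, ?_⟩ <;> refine Int.floor_mono ?_ <;> gcongr
  set F := hfin.toFinset with hF
  have hF0 : ∀ κ ∉ F, ∀ x ∈ dyadic (n + i) κ, x ∉ R := fun κ hκ x hx hxR =>
    hκ (hfin.mem_toFinset.2 ⟨x, hxR, hx⟩)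
  set m : ℤ × ℤ → 𝕜 := fun κ => ⨍ x in dyadic (n + i) κ, b x with hm
  set A : ℤ × ℤ → ℤ × ℤ := fun κ => dyadicIdx n (dyadic_nonempty (n + i) κ).some with hA
  have hAidx : ∀ p, A (dyadicIdx (n + i) p) = dyadicIdx n p := fun p =>
    dyadicIdx_eq_of_le (by omega) (dyadic_nonempty (n + i) (dyadicIdx (n + i) p)).some_mem
  refine ⟨∑ κ ∈ F, m κ • dyadicInd 𝕜 (n + i) κ, ?_, ?_⟩
  · have hz : ∑ κ ∈ F, m κ • ((4 : 𝕜)⁻¹ ^ i) • dyadicInd 𝕜 n (A κ) = 0 := by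
      rw [← Finset.sum_fiberwise_of_maps_to (t := F.image A)
        (fun κ hκ => Finset.mem_image_of_mem A hκ)]
      refine Finset.sum_eq_zero fun κ' _ => ?_
      have h1 : ∀ κ ∈ F.filter (A · = κ'), m κ • ((4 : 𝕜)⁻¹ ^ i) • dyadicInd 𝕜 n (A κ) =
          (m κ) • ((4 : 𝕜)⁻¹ ^ i) • dyadicInd 𝕜 n κ' := fun κ hκ => by
        rw [(Finset.mem_filter.1 hκ).2]
      rw [Finset.sum_congr rfl h1, ← Finset.sum_smul]
      have h2 : ∑ κ ∈ F with A κ = κ', m κ = 0 := by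
        have h3 : ∀ κ, m κ = (((2 : ℝ) ^ (-(n + i))) ^ 2)⁻¹ • ∫ x in dyadic (n + i) κ, b x :=
          fun κ => by rw [hm, setIntegral_dyadic_eq, inv_smul_smul₀ (by positivity)]
        simp only [h3]
        rw [← Finset.smul_sum, ← integral_biUnion_finset _
          (fun κ _ => measurableSet_dyadic (n + i) κ)
          (fun κ _ κ' _ hne => Set.disjoint_left.2 fun p h1 h2 => hne (h1.symm.trans h2))
          (fun κ _ => hb.integrableOn)]
        -- The selected descendants may miss part of the ancestor, but only where `b` vanishes.
        rw [← setIntegral_eq_of_subset_of_ae_sdiff_eq_zero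
          (measurableSet_dyadic n κ').nullMeasurableSet, hmean, smul_zero]
        · refine iUnion₂_subset fun κ hκ p hp => ?_
          rw [mem_dyadic, ← hAidx, mem_dyadic.1 hp]
          exact (Finset.mem_filter.1 hκ).2
        · filter_upwards [h0] with x hx hxd
          refine hx fun hxR => hxd.2 ?_
          refine mem_iUnion₂.2 ⟨dyadicIdx (n + i) x, Finset.mem_filter.2
            ⟨hfin.mem_toFinset.2 ⟨x, hxR, rfl⟩, ?_⟩, mem_dyadic_self _ _⟩
          rw [hAidx]; exact hxd.1
      rw [h2, zero_smul]
    rw [← sub_zero (∑ κ ∈ F, _), ← hz, ← Finset.sum_sub_distrib]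
    refine Submodule.sum_mem _ fun κ _ => ?_
    rw [← smul_sub]
    refine Submodule.smul_mem _ _ ?_
    have := dyadicInd_sub_ancestor_mem (𝕜 := 𝕜) n (dyadic_nonempty (n + i) κ).some i
    rwa [mem_dyadic.1 (dyadic_nonempty (n + i) κ).some_mem] at this
  · have h3 : ∀ᵐ x, ∀ κ ∈ F, (m κ • dyadicInd 𝕜 (n + i) κ) x =
        m κ • if dyadicIdx (n + i) x = κ then (1 : 𝕜) else 0 :=
      (ae_ball_iff F.countable_toSet).2 fun κ _ => by
        filter_upwards [Lp.coeFn_smul (m κ) (dyadicInd 𝕜 (n + i) κ),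
          coeFn_dyadicInd (𝕜 := 𝕜) (n + i) κ] with x h1 h2
        rw [h1, Pi.smul_apply, h2]
    filter_upwards [Lp.coeFn_finsetSum F (fun κ => m κ • dyadicInd 𝕜 (n + i) κ), h3] with x h1 h2
    rw [h1, Finset.sum_apply, Finset.sum_congr rfl h2]
    simp only [smul_eq_mul, mul_ite, mul_one, mul_zero]
    rw [Finset.sum_ite_eq]
    split_ifs with hx
    · rfl
    · refine (setAverage_dyadic_eq_zero ?_).symm
      filter_upwards [h0] with y hy hyd using hy (hF0 _ hx y hyd)

/-! ### Convergence of dyadic averages in the atomic norm -/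

/-- Bounded functions with mean zero on the dyadic squares of some generation are limits of
linear combinations of Haar functions in the atomic norm. -/
theorem exists_mem_haarSpan_atomicSums_le {b : Lp 𝕜 1 (volume : Measure (ℝ × ℝ))} {n : ℤ}
    {c : ℝ × ℝ} {s M : ℝ} (hs : 0 < s) (hM : 0 ≤ M) (hb : ∀ᵐ x, ‖b x‖ ≤ M)
    {R : Set (ℝ × ℝ)} (hR : ∀ p q, dyadicIdx n p = dyadicIdx n q → p ∈ R → q ∈ R)
    (hRs : R ⊆ square c s) (h0 : ∀ᵐ x, x ∉ R → b x = 0)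
    (hmean : ∀ κ, ∫ x in dyadic n κ, b x = 0) {ε : ℝ} (hε : 0 < ε) :
    ∃ w ∈ haarSpan 𝕜, ∃ r ∈ atomicSums (b - w), r ≤ ε := by
  have hbi : Integrable b := L1.integrable_coeFn b
  have hsq : volume (square c s) < ⊤ := by
    rw [volume_square _ hs]; exact ENNReal.ofReal_lt_top
  have hRb : Bornology.IsBounded R :=
    ((Metric.isBounded_Icc _ _).prod (Metric.isBounded_Icc _ _)).subset hRs
  choose w hw hwe using exists_mem_haarSpan_eq_dyadicMean hbi hRb h0 hmean
  have hsub : ∀ i, ∀ᵐ x, (b - w i) x = b x - dyadicMean (n + i) b x := fun i => by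
    filter_upwards [Lp.coeFn_sub b (w i), hwe i] with x h1 h2
    rw [h1, Pi.sub_apply, h2]
  have hE0 : ∀ (i : ℕ) (x), x ∉ R → dyadicMean (n + i) b x = 0 := fun i x hx => by
    refine setAverage_dyadic_eq_zero ?_
    filter_upwards [h0] with y hy hyd
    exact hy fun hyR => hx (hR _ _ (dyadicIdx_eq_of_le (by omega) hyd) hyR)
  have hbd : ∀ i, ∀ᵐ x, ‖(b - w i) x‖ ≤ 2 * M := fun i => by
    filter_upwards [hsub i, hb] with x h1 h2
    rw [h1]
    have h3 : ‖dyadicMean (n + i) b x‖ ≤ M := norm_setAverage_dyadic_le hb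
    linarith [norm_sub_le (b x) (dyadicMean (n + i) b x)]
  have hz : ∀ i, ∀ᵐ x, x ∉ R → (b - w i) x = 0 := fun i => by
    filter_upwards [hsub i, h0] with x h1 h2 hx
    rw [h1, h2 hx, hE0 i x hx, sub_zero]
  have hnorm : Tendsto (fun i => ‖b - w i‖) atTop (𝓝 0) := by
    have key := tendsto_integral_of_dominated_convergence (μ := volume)
      (F := fun (i : ℕ) x => ‖(b - w i) x‖) (f := fun _ => (0 : ℝ))
      ((square c s).indicator fun _ => 2 * M)
      (fun i => (Lp.aestronglyMeasurable (b - w i)).norm)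
      ((integrable_indicator_iff (measurableSet_square c s)).2 (integrableOn_const hsq.ne))
      (fun i => by
        filter_upwards [hbd i, hz i] with x h1 h2
        by_cases hx : x ∈ square c s
        · rw [indicator_of_mem hx, norm_norm]; exact h1
        · rw [indicator_of_notMem hx, h2 fun h => hx (hRs h)]; simp)
      (by
        filter_upwards [ae_tendsto_dyadicMean n hbi.locallyIntegrable, ae_all_iff.2 hsub]
          with x h1 h2
        simp only [h2]
        simpa using ((tendsto_const_nhds (x := b x)).sub h1).norm)
    simpa [L1.norm_eq_integral_norm] using key
  -- The height makes the good part cost `4 l s² = ε / 2`; it does not depend on `i`.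
  set l : ℝ := ε / (8 * s ^ 2) with hl
  have hlpos : 0 < l := by positivity
  obtain ⟨i, hi⟩ := (((hnorm.div_const l).const_mul (2 * (2 * M))).eventually_lt_const
    (u := ε / 2) (by simpa using hε)).exists
  refine ⟨w i, hw i, ?_⟩
  -- The decomposition starts at generation `n + i`, where `b - w i` has mean zero on each square.
  obtain ⟨r, hr, hrle⟩ := exists_mem_atomicSums_le (n := n + i) hs (by positivity) hlpos (hbd i)
    (fun p q hpq => hR p q (dyadicIdx_eq_of_le (by omega) hpq)) hRs (hz i) (fun κ => by
      rw [setIntegral_congr_ae (measurableSet_dyadic _ _)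
        ((hsub i).mono fun x hx _ => hx), integral_sub hbi.integrableOn,
        setIntegral_dyadic_dyadicMean, sub_self]
      exact ((L1.integrable_coeFn (w i)).congr (hwe i)).integrableOn)
  refine ⟨r, hr, hrle.trans ?_⟩
  have : 4 * l * s ^ 2 = ε / 2 := by rw [hl]; field_simp; norm_num
  linarith

/-! ### Quadrants and dyadic squares -/

section quadrants

/-- The indices of the four dyadic squares touching the origin. -/
def quadIdx : Fin 4 → ℤ × ℤ := ![(0, 0), (-1, 0), (-1, -1), (0, -1)]

/-- The index of the dyadic square touching the origin in the quadrant of the square `κ`. -/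
def quadOf (κ : ℤ × ℤ) : ℤ × ℤ := (if 0 ≤ κ.1 then 0 else -1, if 0 ≤ κ.2 then 0 else -1)

lemma quadOf_quadIdx (i : Fin 4) : quadOf (quadIdx i) = quadIdx i := by
  fin_cases i <;> simp [quadOf, quadIdx]

lemma quadIdx_injective : Function.Injective quadIdx := by
  intro i j h
  fin_cases i <;> fin_cases j <;> simp [quadIdx] at h ⊢

lemma ae_coord_ne_zero : ∀ᵐ p : ℝ × ℝ, p.1 ≠ 0 ∧ p.2 ≠ 0 := by
  rw [Measure.volume_eq_prod]
  filter_upwards [Measure.quasiMeasurePreserving_fst.ae (Measure.ae_ne volume (0 : ℝ)),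
    Measure.quasiMeasurePreserving_snd.ae (Measure.ae_ne volume (0 : ℝ))] with p h1 h2
    using ⟨h1, h2⟩

/-- Scaling by `2ⁿ` and taking floors preserve whether a coordinate is nonnegative. The axes, null
sets, are excluded because the quadrants are open. -/
lemma mem_quadrant_iff (n : ℤ) :
    ∀ᵐ p, ∀ i, p ∈ quadrant i ↔ quadOf (dyadicIdx n p) = quadIdx i := by
  filter_upwards [ae_coord_ne_zero] with p hp i
  have key : ∀ x : ℝ, 0 ≤ ⌊(2 : ℝ) ^ n * x⌋ ↔ 0 ≤ x := fun x => by
    rw [Int.floor_nonneg, mul_nonneg_iff_of_pos_left (by positivity)]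
  have h1 : 0 < p.1 ↔ 0 ≤ p.1 := ⟨le_of_lt, fun h => lt_of_le_of_ne h hp.1.symm⟩
  have h2 : 0 < p.2 ↔ 0 ≤ p.2 := ⟨le_of_lt, fun h => lt_of_le_of_ne h hp.2.symm⟩
  simp only [quadOf, dyadicIdx, key]
  fin_cases i <;> simp [quadrant, quadIdx, h1, h2]

lemma measurableSet_quadrant (i : Fin 4) : MeasurableSet (quadrant i) := by
  fin_cases i
  · exact measurableSet_Ioi.prod measurableSet_Ioi
  · exact measurableSet_Iio.prod measurableSet_Ioi
  · exact measurableSet_Iio.prod measurableSet_Iio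
  · exact measurableSet_Ioi.prod measurableSet_Iio

lemma setIntegral_quadrant_of_dyadic {F : ℝ × ℝ → 𝕜} {n : ℤ} {κ : ℤ × ℤ}
    (h : ∀ᵐ x, x ∉ dyadic n κ → F x = 0) (i : Fin 4) :
    ∫ x in quadrant i, F x = if quadOf κ = quadIdx i then ∫ x, F x else 0 := by
  split_ifs with hi
  · refine setIntegral_eq_integral_of_ae_compl_eq_zero ?_
    filter_upwards [h, mem_quadrant_iff n] with x h1 h2 hx
    refine h1 fun hd => hx ((h2 i).2 ?_)
    rw [mem_dyadic.1 hd, hi]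
  · refine setIntegral_eq_zero_of_ae_eq_zero ?_
    filter_upwards [h, mem_quadrant_iff n] with x h1 h2 hx
    refine h1 fun hd => hi ?_
    rw [← mem_dyadic.1 hd, (h2 i).1 hx]

lemma sum_setIntegral_quadrant {F : ℝ × ℝ → 𝕜} (hF : Integrable F) :
    ∑ i, ∫ x in quadrant i, F x = ∫ x, F x := by
  simp only [← integral_indicator (measurableSet_quadrant _)]
  rw [← integral_finsetSum _ fun i _ => hF.indicator (measurableSet_quadrant i)]
  refine integral_congr_ae ?_
  filter_upwards [mem_quadrant_iff 0] with p hp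
  classical
  simp only [indicator_apply, hp, quadOf]
  split_ifs <;> simp [Fin.sum_univ_four, quadIdx]

lemma haar_mem_HA (j : Fin 3) (n k l : ℤ) : haar 𝕜 j n k l ∈ HA 𝕜 := by
  intro i
  have hF : H1.toL1 (haar 𝕜 j n k l) =ᵐ[volume] fun p => (haarFun j n k l p : 𝕜) :=
    (memLp_haarFun 𝕜 j n k l).coeFn_toLp
  rw [setIntegral_quadrant_of_dyadic (n := n) (κ := (k, l))]
  · rw [integral_congr_ae hF, integral_ofReal, integral_haarFun]; simp
  · filter_upwards [hF, (dyadic_ae_eq_square n (k, l)).mem_iff] with x h1 h2 hx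
    rw [h1, haarFun_eq_zero j n k l (fun h => hx (h2.2 h))]; simp

/-- The square with centre `0` and side `2 * 2⁻ⁿ`, as a union of four dyadic squares. -/
def centralSquare (n : ℤ) : Set (ℝ × ℝ) := {p | ∃ i, dyadicIdx n p = quadIdx i}

lemma centralSquare_subset (n : ℤ) : centralSquare n ⊆
    square (-(2 : ℝ) ^ (-n), -(2 : ℝ) ^ (-n)) (2 * (2 : ℝ) ^ (-n)) := by
  rintro p ⟨i, hi⟩
  have h := dyadic_subset_square n _ (mem_dyadic.2 hi)
  have h2 : (0 : ℝ) < 2 ^ (-n) := by positivity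
  simp only [square, corner, mem_prod, mem_Icc] at h ⊢
  fin_cases i <;> simp [quadIdx] at h ⊢ <;> grind

lemma mem_centralSquare_of_norm_lt {n : ℤ} {p : ℝ × ℝ} (h : ‖p‖ < (2 : ℝ) ^ (-n)) :
    p ∈ centralSquare n := by
  have h2 : (0 : ℝ) < 2 ^ n := by positivity
  have key : ∀ x : ℝ, |x| < (2 : ℝ) ^ (-n) → ⌊(2 : ℝ) ^ n * x⌋ = 0 ∨ ⌊(2 : ℝ) ^ n * x⌋ = -1 := by
    intro x hx
    have h3 : |(2 : ℝ) ^ n * x| < 1 := by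
      rw [abs_mul, abs_of_pos h2]
      calc (2 : ℝ) ^ n * |x| < 2 ^ n * 2 ^ (-n) := by gcongr
        _ = 1 := by rw [zpow_neg, mul_inv_cancel₀ h2.ne']
    rw [abs_lt] at h3
    rw [Int.floor_eq_iff, Int.floor_eq_iff]
    push_cast
    rcases le_or_gt 0 ((2 : ℝ) ^ n * x) with h4 | h4
    · left; constructor <;> linarith [h3.2]
    · right; constructor <;> linarith [h3.1]
  rw [Prod.norm_def, max_lt_iff] at h
  have e1 := key p.1 h.1
  have e2 := key p.2 h.2
  rw [centralSquare, mem_ofPred_eq, dyadicIdx]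
  rcases e1 with e1 | e1 <;> rcases e2 with e2 | e2 <;> rw [e1, e2]
  exacts [⟨0, rfl⟩, ⟨3, rfl⟩, ⟨1, rfl⟩, ⟨2, rfl⟩]

/-- Inside the central square, a quadrant and the dyadic square at the origin in it coincide almost
everywhere; the remaining dyadic squares miss the support. -/
lemma setIntegral_dyadic_eq_zero_of_quadrant {b : ℝ × ℝ → 𝕜} {n : ℤ}
    (h0 : ∀ᵐ x, x ∉ centralSquare n → b x = 0) (hq : ∀ i, ∫ x in quadrant i, b x = 0)
    (κ : ℤ × ℤ) : ∫ x in dyadic n κ, b x = 0 := by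
  by_cases hκ : ∃ i, κ = quadIdx i
  · obtain ⟨i, rfl⟩ := hκ
    rw [← hq i, ← integral_indicator (measurableSet_dyadic n _),
      ← integral_indicator (measurableSet_quadrant i)]
    refine integral_congr_ae ?_
    filter_upwards [h0, mem_quadrant_iff n] with x h1 h2
    by_cases hx : x ∈ centralSquare n
    · obtain ⟨j, hj⟩ := hx
      have : x ∈ dyadic n (quadIdx i) ↔ x ∈ quadrant i := by
        rw [h2 i, mem_dyadic, hj, quadOf_quadIdx]
      by_cases hd : x ∈ dyadic n (quadIdx i)
      · rw [indicator_of_mem hd, indicator_of_mem (this.1 hd)]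
      · rw [indicator_of_notMem hd, indicator_of_notMem fun h => hd (this.2 h)]
    · rw [indicator_apply_eq_zero.2 fun _ => h1 hx, indicator_apply_eq_zero.2 fun _ => h1 hx]
  · refine setIntegral_eq_zero_of_ae_eq_zero ?_
    filter_upwards [h0] with x h1 hx
    exact h1 fun ⟨i, hi⟩ => hκ ⟨i, hx.symm.trans hi⟩

end quadrants

/-! ### Reduction to bounded functions with zero quadrant integrals -/

/-- The bounded functions of bounded support. -/
def boundedSupp (𝕜 : Type*) [RCLike 𝕜] :
    Submodule 𝕜 (Lp 𝕜 1 (volume : Measure (ℝ × ℝ))) where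
  carrier := {f | ∃ K : ℝ, 0 ≤ K ∧ ∀ᵐ x, ‖f x‖ ≤ K ∧ (K < ‖x‖ → f x = 0)}
  zero_mem' := ⟨0, le_rfl, by
    filter_upwards [Lp.coeFn_zero 𝕜 1 (volume : Measure (ℝ × ℝ))] with x hx
    rw [hx]; simp⟩
  add_mem' := by
    rintro f g ⟨K, hK, hf⟩ ⟨L, hL, hg⟩
    refine ⟨K + L, by positivity, ?_⟩
    filter_upwards [Lp.coeFn_add f g, hf, hg] with x h1 h2 h3
    rw [h1, Pi.add_apply]
    refine ⟨(norm_add_le _ _).trans (add_le_add h2.1 h3.1), fun hx => ?_⟩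
    rw [h2.2 (by linarith), h3.2 (by linarith), add_zero]
  smul_mem' := by
    rintro c f ⟨K, hK, hf⟩
    -- One constant bounds both the values and the support, so it must not drop below `K` when `‖c‖
    -- < 1`.
    refine ⟨(1 + ‖c‖) * K, by positivity, ?_⟩
    filter_upwards [Lp.coeFn_smul c f, hf] with x h1 h2
    have hc := norm_nonneg c
    rw [h1, Pi.smul_apply, norm_smul]
    refine ⟨?_, fun hx => ?_⟩
    · nlinarith [h2.1, mul_le_mul_of_nonneg_left h2.1 hc]
    · rw [h2.2 (by nlinarith), smul_zero]

lemma mem_boundedSupp_of_square {f : Lp 𝕜 1 (volume : Measure (ℝ × ℝ))} {c : ℝ × ℝ} {s M : ℝ}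
    (h0 : ∀ᵐ x, x ∉ square c s → f x = 0) (hb : ∀ᵐ x, ‖f x‖ ≤ M) : f ∈ boundedSupp 𝕜 := by
  obtain ⟨r, hr⟩ := ((Metric.isBounded_Icc c.1 (c.1 + s)).prod
    (Metric.isBounded_Icc c.2 (c.2 + s))).subset_closedBall (0 : ℝ × ℝ)
  refine ⟨max 0 (max M r), le_max_left _ _, ?_⟩
  filter_upwards [h0, hb] with x h1 h2
  refine ⟨h2.trans ((le_max_left _ _).trans (le_max_right _ _)), fun hx => h1 fun hxs => ?_⟩
  have h3 : x ∈ Metric.closedBall (0 : ℝ × ℝ) r := hr hxs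
  rw [mem_closedBall_zero_iff] at h3
  have := (le_max_right M r).trans (le_max_right 0 _)
  linarith

lemma IsAtom.mem_boundedSupp {a : Lp 𝕜 1 (volume : Measure (ℝ × ℝ))} (ha : IsAtom a) :
    a ∈ boundedSupp 𝕜 := by
  obtain ⟨c, s, -, h0, hb, -⟩ := ha
  exact mem_boundedSupp_of_square h0 hb

lemma IsAtom.integral_eq_zero {a : Lp 𝕜 1 (volume : Measure (ℝ × ℝ))} (ha : IsAtom a) :
    setIntegralL 𝕜 univ a = 0 := by
  obtain ⟨c, s, -, h0, -, h⟩ := ha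
  rw [setIntegralL_apply, setIntegral_univ,
    ← setIntegral_eq_integral_of_ae_compl_eq_zero h0, h]

/-- Approximation of a function in `H¹(ℝ²)` by finite sums of atoms. -/
lemma exists_boundedSupp_atomicSums_le {f : Lp 𝕜 1 (volume : Measure (ℝ × ℝ))}
    (hf : (atomicSums f).Nonempty) {ε : ℝ} (hε : 0 < ε) :
    ∃ g ∈ boundedSupp 𝕜, setIntegralL 𝕜 univ g = 0 ∧ ∃ r ∈ atomicSums (f - g), r ≤ ε := by
  obtain ⟨-, c, a, ⟨ha, hc, hs⟩, -⟩ := hf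
  -- The tail of the decomposition is itself a decomposition of the remainder.
  obtain ⟨N, hN⟩ := ((tendsto_sum_nat_add fun j => ‖c j‖).eventually
    (gt_mem_nhds hε)).exists
  refine ⟨∑ j ∈ Finset.range N, c j • a j,
    Submodule.sum_mem _ fun j _ => Submodule.smul_mem _ _ (ha j).mem_boundedSupp, ?_,
    _, ⟨fun j => c (j + N), fun j => a (j + N), ⟨fun j => ha _, ?_, ?_⟩, rfl⟩, hN.le⟩
  · rw [map_sum]
    exact Finset.sum_eq_zero fun j _ => by rw [map_smul, (ha j).integral_eq_zero, smul_zero]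
  · exact (summable_nat_add_iff N).2 hc
  · exact (hasSum_nat_add_iff' N).2 hs

lemma integral_dyadicInd (n : ℤ) (κ : ℤ × ℤ) :
    ∫ x, dyadicInd 𝕜 n κ x = ((((2 : ℝ) ^ (-n)) ^ 2 : ℝ) : 𝕜) := by
  rw [dyadicInd, integral_indicatorConstLp, volume_real_dyadic, RCLike.real_smul_eq_coe_mul,
    mul_one]

lemma setIntegral_quadrant_dyadicInd (i j : Fin 4) :
    setIntegralL 𝕜 (quadrant i) (dyadicInd 𝕜 0 (quadIdx j)) = if j = i then 1 else 0 := by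
  rw [setIntegralL_apply, setIntegral_quadrant_of_dyadic (n := 0) (κ := quadIdx j),
    quadOf_quadIdx, integral_dyadicInd]
  · simp [quadIdx_injective.eq_iff]
  · filter_upwards [coeFn_dyadicInd (𝕜 := 𝕜) 0 (quadIdx j)] with x hx hd
    rw [hx, if_neg fun h => hd (mem_dyadic.2 h)]

/-- A function with small prescribed integrals over the quadrants and small atomic norm. -/
lemma exists_quadrant_correction {e : Fin 4 → 𝕜} {δ : ℝ} (hδ : 0 ≤ δ) (he : ∀ i, ‖e i‖ ≤ δ)
    (hsum : ∑ i, e i = 0) :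
    ∃ h ∈ boundedSupp 𝕜, (∀ i, setIntegralL 𝕜 (quadrant i) h = e i) ∧
      16 * δ ∈ atomicSums h := by
  set h : Lp 𝕜 1 (volume : Measure (ℝ × ℝ)) := ∑ j, e j • dyadicInd 𝕜 0 (quadIdx j) with hh
  have hae : ∀ᵐ x, h x = ∑ j, e j * if dyadicIdx 0 x = quadIdx j then 1 else 0 := by
    have h3 : ∀ᵐ x, ∀ j, (e j • dyadicInd 𝕜 0 (quadIdx j)) x =
        e j * if dyadicIdx 0 x = quadIdx j then (1 : 𝕜) else 0 :=
      ae_all_iff.2 fun j => by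
        filter_upwards [Lp.coeFn_smul (e j) (dyadicInd 𝕜 0 (quadIdx j)),
          coeFn_dyadicInd (𝕜 := 𝕜) 0 (quadIdx j)] with x h1 h2
        rw [h1, Pi.smul_apply, h2, smul_eq_mul]
    filter_upwards [Lp.coeFn_finsetSum Finset.univ (fun j => e j • dyadicInd 𝕜 0 (quadIdx j)), h3]
      with x h1 h2
    rw [hh, h1, Finset.sum_apply, Finset.sum_congr rfl fun j _ => h2 j]
  have hb : ∀ᵐ x, ‖h x‖ ≤ 4 * δ := by
    filter_upwards [hae] with x hx
    rw [hx]
    refine (norm_sum_le_of_le Finset.univ (f := fun j => e j * if dyadicIdx 0 x = quadIdx j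
      then (1 : 𝕜) else 0) (n := fun _ => δ) fun j _ => ?_).trans (by simp)
    split_ifs
    · rw [mul_one]; exact he j
    · simpa using hδ
  have h0 : ∀ᵐ x, x ∉ square (-1, -1) 2 → h x = 0 := by
    filter_upwards [hae] with x hx hxs
    rw [hx]
    refine Finset.sum_eq_zero fun j _ => ?_
    rw [if_neg, mul_zero]
    intro hj
    have := centralSquare_subset 0 ⟨j, hj⟩
    norm_num at this
    exact hxs this
  have hint : ∀ i, setIntegralL 𝕜 (quadrant i) h = e i := fun i => by
    rw [hh, map_sum]
    simp [map_smul, setIntegral_quadrant_dyadicInd]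
  refine ⟨h, mem_boundedSupp_of_square h0 hb, hint, ?_⟩
  have h1 : ∫ x, h x = 0 := by
    rw [← sum_setIntegral_quadrant (L1.integrable_coeFn h), ← hsum]
    exact Finset.sum_congr rfl fun i _ => hint i
  -- The constant is the bound `4 δ` times the area 4 of the square of side 2.
  convert mem_atomicSums_of_bounded two_pos (by positivity) h0 hb h1 using 1
  ring

/-- A large enough central square contains the support, and its generation, which is negative or
zero, serves as the starting one: zero quadrant integrals become zero dyadic means. -/
lemma exists_haarSpan_of_boundedSupp {b : Lp 𝕜 1 (volume : Measure (ℝ × ℝ))}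
    (hb : b ∈ boundedSupp 𝕜) (hq : ∀ i, setIntegralL 𝕜 (quadrant i) b = 0) {ε : ℝ} (hε : 0 < ε) :
    ∃ w ∈ haarSpan 𝕜, ∃ r ∈ atomicSums (b - w), r ≤ ε := by
  obtain ⟨K, hK, h⟩ := hb
  obtain ⟨N, hN⟩ := pow_unbounded_of_one_lt K (one_lt_two (α := ℝ))
  have h0 : ∀ᵐ x, x ∉ centralSquare (-N : ℤ) → b x = 0 := by
    filter_upwards [h] with x hx hxc
    refine hx.2 ?_
    by_contra hle
    refine hxc (mem_centralSquare_of_norm_lt ?_)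
    rw [neg_neg, zpow_natCast]
    linarith
  refine exists_mem_haarSpan_atomicSums_le (by positivity) hK (h.mono fun x hx => hx.1)
    (fun p q hpq => ?_) (centralSquare_subset _) h0
    (setIntegral_dyadic_eq_zero_of_quadrant h0 hq) hε
  rintro ⟨i, hi⟩
  exact ⟨i, hpq ▸ hi⟩

/-! ### The two inclusions -/

lemma isClosed_HA : IsClosed (HA 𝕜 : Set (H1 𝕜)) := by
  have hc : Continuous (H1.toL1 : H1 𝕜 → Lp 𝕜 1 (volume : Measure (ℝ × ℝ))) :=
    (LinearMap.mkContinuous H1.toL1 1 fun f => by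
      rw [one_mul]; exact H1.norm_toL1_le f).continuous
  have : (HA 𝕜 : Set (H1 𝕜)) =
      ⋂ i, {f | setIntegralL 𝕜 (quadrant i) (H1.toL1 f) = 0} := by
    ext f
    rw [mem_iInter]
    rfl
  rw [this]
  exact isClosed_iInter fun i =>
    isClosed_eq ((setIntegralL 𝕜 (quadrant i)).continuous.comp hc) continuous_const

lemma exists_span_haarSystem_norm_sub_lt {f : H1 𝕜} (hf : f ∈ HA 𝕜) {ε : ℝ} (hε : 0 < ε) :
    ∃ w ∈ Submodule.span 𝕜 (haarSystem 𝕜), ‖f - w‖ < ε := by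
  -- The truncation, the correction and the Haar approximation cost `1 + 16 + 1 = 18` twentieths of
  -- `ε`.
  have hδ : 0 < ε / 20 := by positivity
  obtain ⟨g, hg, hg0, r, hr, hrle⟩ :=
    exists_boundedSupp_atomicSums_le (H1.nonempty_atomicSums f) hδ
  have hfi : ∀ i, setIntegralL 𝕜 (quadrant i) (H1.toL1 f) = 0 := hf
  have he : ∀ i, ‖setIntegralL 𝕜 (quadrant i) g‖ ≤ ε / 20 := fun i => by
    have h1 := norm_setIntegralL_le (quadrant i) (H1.toL1 f - g)
    rw [map_sub, hfi, zero_sub, norm_neg] at h1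
    exact h1.trans ((norm_le_of_mem_atomicSums hr).trans hrle)
  have hsum : ∑ i, setIntegralL 𝕜 (quadrant i) g = 0 := by
    rw [← hg0, setIntegralL_apply, setIntegral_univ,
      ← sum_setIntegral_quadrant (L1.integrable_coeFn g)]
    rfl
  obtain ⟨h, hh, hhi, hhs⟩ := exists_quadrant_correction hδ.le he hsum
  obtain ⟨_, ⟨w, hw, rfl⟩, t, ht, htle⟩ := exists_haarSpan_of_boundedSupp (sub_mem hg hh)
    (fun i => by rw [map_sub, hhi, sub_self]) hδ
  refine ⟨w, hw, ?_⟩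
  have hmem := add_mem_atomicSums (add_mem_atomicSums hr hhs) ht
  rw [show H1.toL1 f - g + h + (g - h - H1.toL1 w) = H1.toL1 (f - w) by
    rw [map_sub]; abel] at hmem
  refine (H1.norm_le_of_mem hmem).trans_lt ?_
  linarith

end HardyHaar

end

theorem theorem4p1 (𝕜 : Type*) [RCLike 𝕜] :
    (Submodule.span 𝕜 (HardyHaar.haarSystem 𝕜)).topologicalClosure = HardyHaar.HA 𝕜 := by
  refine le_antisymm ?_ fun f hf => ?_
  · refine Submodule.topologicalClosure_minimal _ (Submodule.span_le.2 ?_) HardyHaar.isClosed_HA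
    rintro _ ⟨j, n, k, l, rfl⟩
    exact HardyHaar.haar_mem_HA j n k l
  · refine Metric.mem_closure_iff.2 fun ε hε => ?_
    obtain ⟨w, hw, h⟩ := HardyHaar.exists_span_haarSystem_norm_sub_lt hf hε
    exact ⟨w, hw, by rwa [dist_eq_norm]⟩
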